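/- Let $q\ge 2$. A $q$-spin system $\mathcal S=(G,\lambda,A)$ consists of a finite simple graph $G=(V,E)$, $V=\{0,\dots,n-1\}$, external fields $\lambda_v\in\mathbb R_{\ge 0}^q$ $(v\in V)$ and interaction matrices $A_e\in\mathbb R_{\ge0}^{q\times q}$ $(e\in E)$. When the partition function is positive, its Gibbs distribution on $[q]^V$ is $$\mu(\sigma)\propto\prod_{v\in V}\lambda_v(\sigma(v))\prod_{e=(u,v)\in E}A_e(\sigma(u),\sigma(v)),$$ and for $\Lambda\subseteq V$, $\mu_\Lambda(\tau)=\sum_{\sigma:\sigma_\Lambda=\tau}\mu(\sigma)$ denotes the marginal distribution on $[q]^\Lambda$. For $\delta>0$, call $\mathcal S$ *$\delta$-tractable* if $G$ has maximum degree $\Delta\ge1$, $\sum_c\lambda_v(c)=1$ for every $v\in V$, and for every $e\in E$, $\max_{a,b}A_e(a,b)=1$ and $$A_e(a,b)\ \ge\ 1-\frac{1-\delta}{2\Delta}\qquad\text{for all }a,b\in[q].$$ *Model of computation.* Algorithms are fixed programs for a unit-cost random access machine with integer and real arithmetic. The program is given $n,q,\Delta,\delta$ and a list of the queried vertices. It sees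 $\mathcal S$ only through probes, each taking one unit of time: the $i$-th neighbour of a vertex (from an adjacency list in arbitrary order), one entry $\lambda_v(c)$, or one entry $A_e(a,b)$. It may read independent uniform random numbers in $[0,1]$, stored in an infinite array, at one unit of time each, and may use such a number to draw a spin distributed as $\lambda_v$ at a cost of $O(\log q)$. **Theorem.** There is one such program with the following property. For every $\delta>0$ there is a constant $K$, depending only on $\delta$, such that for every $q\ge2$, every $\delta$-tractable $q$-spin system $\mathcal S$ with Gibbs distribution $\mu$ and every $\Lambda\subseteq V$, the program, on query $\Lambda$, halts with probability $1$, its output $X\in[q]^\Lambda$ is distributed exactly according to $\mu_\Lambda$, and its expected running time is at most $$K\cdot\Delta\,\log q\cdot\max(1,|\Lambda|).$$ -/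

import Mathlib

open MeasureTheory
open scoped ENNReal

/-! ### Spin systems and Gibbs distributions -/

/-- A `q`-spin system on a finite simple graph with vertex set `{0, …, n-1}` and spins
`{0, …, q-1}`. The interaction matrix of an edge `e = {u, v}` is stored in both orientations:
`inter u v a b` is the entry of `A_e` for spin `a` at `u` and spin `b` at `v`, so the matrix for
`(v, u)` is the transpose of the matrix for `(u, v)`. -/
structure SpinSystem (n q : ℕ) where
  graph : SimpleGraph (Fin n)
  field : Fin n → Fin q → ℝ
  inter : Fin n → Fin n → Fin q → Fin q → ℝ
  field_nonneg : ∀ v c, 0 ≤ field v c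
  inter_nonneg : ∀ u v, graph.Adj u v → ∀ a b, 0 ≤ inter u v a b
  inter_symm : ∀ u v, graph.Adj u v → ∀ a b, inter u v a b = inter v u b a

namespace SpinSystem

variable {n q : ℕ}

open Classical in
/-- The maximum degree `Δ` of the underlying graph. -/
noncomputable def maxDeg (S : SpinSystem n q) : ℕ := S.graph.maxDegree

open Classical in
/-- The edges, each listed once, with its smaller endpoint first. -/
noncomputable def edges (S : SpinSystem n q) : Finset (Fin n × Fin n) :=
  Finset.univ.filter fun p => S.graph.Adj p.1 p.2 ∧ p.1 < p.2

/-- The weight `w(σ) = ∏_v λ_v(σ(v)) ∏_{e = (u,v)} A_e(σ(u), σ(v))`. -/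
noncomputable def weight (S : SpinSystem n q) (σ : Fin n → Fin q) : ℝ :=
  (∏ v, S.field v (σ v)) * ∏ p ∈ S.edges, S.inter p.1 p.2 (σ p.1) (σ p.2)

/-- The partition function `Z`. -/
noncomputable def partitionFunction (S : SpinSystem n q) : ℝ := ∑ σ, S.weight σ

/-- The Gibbs distribution `μ(σ) = w(σ) / Z`. -/
noncomputable def gibbs (S : SpinSystem n q) (σ : Fin n → Fin q) : ℝ :=
  S.weight σ / S.partitionFunction

open Classical in
/-- The marginal `μ_Λ(τ) = ∑_{σ : σ_Λ = τ} μ(σ)`, for `τ ∈ [q]^Λ`. -/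
noncomputable def marginal (S : SpinSystem n q) (Λ : Finset (Fin n)) (τ : Λ → Fin q) : ℝ :=
  ∑ σ ∈ Finset.univ.filter (fun σ : Fin n → Fin q => ∀ v : Λ, σ v = τ v), S.gibbs σ

/-- The tractable regime: maximum degree at least one, normalized parameters, and soft
constraints `A_e(a, b) ≥ C(Δ, δ) = 1 - (1 - δ) / (2Δ)`. -/
structure Tractable (S : SpinSystem n q) (δ : ℝ) : Prop where
  one_le_maxDeg : 1 ≤ S.maxDeg
  field_normalized : ∀ v, ∑ c, S.field v c = 1
  inter_normalized : ∀ u v, S.graph.Adj u v →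
    IsGreatest (Set.range fun p : Fin q × Fin q => S.inter u v p.1 p.2) 1
  soft : ∀ u v, S.graph.Adj u v → ∀ a b, 1 - (1 - δ) / (2 * (S.maxDeg : ℝ)) ≤ S.inter u v a b

end SpinSystem

/-- An adjacency-list representation of a graph: the neighbours of each vertex, each exactly once,
in an arbitrary order. -/
structure AdjacencyList {n : ℕ} (G : SimpleGraph (Fin n)) where
  nbrs : Fin n → List (Fin n)
  nodup : ∀ v, (nbrs v).Nodup
  mem_nbrs : ∀ v u, u ∈ nbrs v ↔ G.Adj v u

/-! ### The computation model: a randomized unit-cost RAM with probe access to a spin system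

Programs are finite `while` programs. They use integer registers, real registers and
integer arrays (all indexed by numerals fixed in the program; array cells are indexed by arbitrary
integers). A program is one fixed syntactic object: it does not depend on the instance, which it
sees only through probes of single neighbours and of single entries of the fields and matrices. The
source of randomness is an infinite array of independent uniform numbers in `[0, 1]`; reading a cell
that has not been read before amounts to drawing a fresh number. -/

/-- An instance for probing: a spin system whose graph is stored as an adjacency list. -/
structure ProbeInput where
  n : ℕ
  q : ℕ
  sys : SpinSystem n q
  adj : AdjacencyList sys.graph

/-- The contents of the random array. -/
abbrev RandomTape : Type := ℤ → unitInterval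

/-- The cells of the random array are independent and uniform in `[0, 1]`. -/
noncomputable def tapeMeasure : Measure RandomTape :=
  Measure.infinitePi fun _ : ℤ => (volume : Measure unitInterval)

/-- The element of `{0, …, n-1}` that an integer names, if any. -/
def Int.toFin? (n : ℕ) (z : ℤ) : Option (Fin n) :=
  if h : 0 ≤ z ∧ z < n then some ⟨z.toNat, by omega⟩ else none

namespace ProbeInput

/-- Probe: the `i`-th neighbour (counted from `0`) of vertex `v`, and `-1` if there is none. -/
def probeNbr (I : ProbeInput) (v i : ℤ) : ℤ :=
  match Int.toFin? I.n v with
  | some v => if 0 ≤ i then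
      (match (I.adj.nbrs v)[i.toNat]? with
        | some u => ((u : ℕ) : ℤ)
        | none => -1)
      else -1
  | none => -1

/-- Probe: the entry `λ_v(c)`, and `0` if `v` is not a vertex or `c` is not a spin. -/
noncomputable def probeField (I : ProbeInput) (v c : ℤ) : ℝ :=
  match Int.toFin? I.n v, Int.toFin? I.q c with
  | some v, some c => I.sys.field v c
  | _, _ => 0

open Classical in
/-- Probe: the entry `A_e(a, b)` for the edge `e = (u, v)`, and `0` if `(u, v)` is not an edge or
`a`, `b` are not both spins. -/
noncomputable def probeInter (I : ProbeInput) (u v a b : ℤ) : ℝ :=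
  match Int.toFin? I.n u, Int.toFin? I.n v, Int.toFin? I.q a, Int.toFin? I.q b with
  | some u, some v, some a, some b => if I.sys.graph.Adj u v then I.sys.inter u v a b else 0
  | _, _, _, _ => 0

open Classical in
/-- Inverse-transform sampling from `λ_v`: the number of spins `c` with
`λ_v(0) + ⋯ + λ_v(c) ≤ r`, which for a probability vector `λ_v` and `r < 1` is the least spin `c`
with `r < λ_v(0) + ⋯ + λ_v(c)`. For `r` uniform in `[0, 1]` it is distributed as `λ_v`. -/
noncomputable def spinOf (I : ProbeInput) (v : ℤ) (r : ℝ) : ℤ :=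
  match Int.toFin? I.n v with
  | some v =>
      ((Finset.univ.filter fun c : Fin I.q => ∑ c' ∈ Finset.Iic c, I.sys.field v c' ≤ r).card : ℤ)
  | none => 0

end ProbeInput

namespace RAM

/-- The memory of the machine. -/
structure State where
  int : ℕ → ℤ
  real : ℕ → ℝ
  arr : ℕ → ℤ → ℤ

/-- Integer expressions. -/
inductive IExpr : Type
  | const (k : ℤ)
  | reg (x : ℕ)
  | arr (a : ℕ) (i : IExpr)
  | add (e f : IExpr)
  | sub (e f : IExpr)
  | mul (e f : IExpr)
  | div (e f : IExpr)
  | mod (e f : IExpr)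
  | nbr (v i : IExpr)

/-- Real expressions. -/
inductive RExpr : Type
  | ofInt (e : IExpr)
  | reg (x : ℕ)
  | add (e f : RExpr)
  | sub (e f : RExpr)
  | mul (e f : RExpr)
  | div (e f : RExpr)
  | field (v c : IExpr)
  | inter (u v a b : IExpr)
  | rand (a : IExpr)

/-- Tests: comparisons `e ≤ f` of integers or of reals. -/
inductive Test : Type
  | ile (e f : IExpr)
  | rle (e f : RExpr)

/-- Programs. `sample x v a` puts into the integer register `x` a spin distributed as `λ_v`,
obtained from cell `a` of the random array. -/
inductive Cmd : Type
  | skip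
  | setInt (x : ℕ) (e : IExpr)
  | setReal (x : ℕ) (e : RExpr)
  | setArr (a : ℕ) (i e : IExpr)
  | sample (x : ℕ) (v a : IExpr)
  | seq (c d : Cmd)
  | ite (b : Test) (c d : Cmd)
  | while (b : Test) (c : Cmd)

/-- The value of an integer expression. Division and remainder are Euclidean. -/
def IExpr.eval (I : ProbeInput) (s : State) : IExpr → ℤ
  | const k => k
  | reg x => s.int x
  | arr a i => s.arr a (i.eval I s)
  | add e f => e.eval I s + f.eval I s
  | sub e f => e.eval I s - f.eval I s
  | mul e f => e.eval I s * f.eval I s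
  | div e f => e.eval I s / f.eval I s
  | mod e f => e.eval I s % f.eval I s
  | nbr v i => I.probeNbr (v.eval I s) (i.eval I s)

/-- The value of a real expression. -/
noncomputable def RExpr.eval (I : ProbeInput) (ω : RandomTape) (s : State) : RExpr → ℝ
  | ofInt e => (e.eval I s : ℝ)
  | reg x => s.real x
  | add e f => e.eval I ω s + f.eval I ω s
  | sub e f => e.eval I ω s - f.eval I ω s
  | mul e f => e.eval I ω s * f.eval I ω s
  | div e f => e.eval I ω s / f.eval I ω s
  | field v c => I.probeField (v.eval I s) (c.eval I s)
  | inter u v a b => I.probeInter (u.eval I s) (v.eval I s) (a.eval I s) (b.eval I s)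
  | rand a => (ω (a.eval I s) : ℝ)

/-- Evaluating an expression takes one unit of time for each operation, memory access or probe. -/
def IExpr.cost : IExpr → ℕ
  | const _ => 1
  | reg _ => 1
  | arr _ i => i.cost + 1
  | add e f => e.cost + f.cost + 1
  | sub e f => e.cost + f.cost + 1
  | mul e f => e.cost + f.cost + 1
  | div e f => e.cost + f.cost + 1
  | mod e f => e.cost + f.cost + 1
  | nbr v i => v.cost + i.cost + 1

/-- Evaluating an expression takes one unit of time for each operation, memory access, probe or
random number. -/
def RExpr.cost : RExpr → ℕ
  | ofInt e => e.cost + 1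
  | reg _ => 1
  | add e f => e.cost + f.cost + 1
  | sub e f => e.cost + f.cost + 1
  | mul e f => e.cost + f.cost + 1
  | div e f => e.cost + f.cost + 1
  | field v c => v.cost + c.cost + 1
  | inter u v a b => u.cost + v.cost + a.cost + b.cost + 1
  | rand a => a.cost + 1

/-- The truth of a test. -/
def Test.Holds (I : ProbeInput) (ω : RandomTape) (s : State) : Test → Prop
  | ile e f => e.eval I s ≤ f.eval I s
  | rle e f => e.eval I ω s ≤ f.eval I ω s

/-- The cost of a test. -/
def Test.cost : Test → ℕ
  | ile e f => e.cost + f.cost + 1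
  | rle e f => e.cost + f.cost + 1

/-- `Exec I ω c s k s'`: on instance `I` with random array `ω`, the program `c` started in memory
state `s` halts after exactly `k` units of time in memory state `s'`. Assignments and tests take one
unit of time beyond the evaluation of their expressions; sampling a spin takes `⌈log₂ q⌉` units
beyond that. -/
inductive Exec (I : ProbeInput) (ω : RandomTape) : Cmd → State → ℕ → State → Prop
  | skip (s : State) : Exec I ω .skip s 1 s
  | setInt (s : State) (x : ℕ) (e : IExpr) :
      Exec I ω (.setInt x e) s (e.cost + 1) { s with int := Function.update s.int x (e.eval I s) }
  | setReal (s : State) (x : ℕ) (e : RExpr) :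
      Exec I ω (.setReal x e) s (e.cost + 1)
        { s with real := Function.update s.real x (e.eval I ω s) }
  | setArr (s : State) (a : ℕ) (i e : IExpr) :
      Exec I ω (.setArr a i e) s (i.cost + e.cost + 1)
        { s with
          arr := Function.update s.arr a (Function.update (s.arr a) (i.eval I s) (e.eval I s)) }
  | sample (s : State) (x : ℕ) (v a : IExpr) :
      Exec I ω (.sample x v a) s (v.cost + a.cost + Nat.clog 2 I.q + 1)
        { s with int := Function.update s.int x (I.spinOf (v.eval I s) (ω (a.eval I s))) }
  | seq {c d : Cmd} {s s₁ s₂ : State} {k l : ℕ} :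
      Exec I ω c s k s₁ → Exec I ω d s₁ l s₂ → Exec I ω (.seq c d) s (k + l) s₂
  | iteTrue {b : Test} {c d : Cmd} {s s₁ : State} {k : ℕ} :
      b.Holds I ω s → Exec I ω c s k s₁ → Exec I ω (.ite b c d) s (b.cost + k) s₁
  | iteFalse {b : Test} {c d : Cmd} {s s₁ : State} {k : ℕ} :
      ¬ b.Holds I ω s → Exec I ω d s k s₁ → Exec I ω (.ite b c d) s (b.cost + k) s₁
  | whileTrue {b : Test} {c : Cmd} {s s₁ s₂ : State} {k l : ℕ} :
      b.Holds I ω s → Exec I ω c s k s₁ → Exec I ω (.while b c) s₁ l s₂ →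
        Exec I ω (.while b c) s (b.cost + k + l) s₂
  | whileFalse {b : Test} {c : Cmd} {s : State} :
      ¬ b.Holds I ω s → Exec I ω (.while b c) s b.cost s

/-- Execution is deterministic once the random array is fixed, so the running time and the final
memory state are well defined. -/
theorem Exec.det {I : ProbeInput} {ω : RandomTape} {c : Cmd} {s s₁ : State} {k : ℕ}
    (h : Exec I ω c s k s₁) : ∀ {l : ℕ} {s₂ : State}, Exec I ω c s l s₂ → k = l ∧ s₁ = s₂ := by
  induction h with
  | skip | setInt | setReal | setArr | sample => intro l s₂ h; cases h; exact ⟨rfl, rfl⟩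
  | seq _ _ ih₁ ih₂ =>
    intro l s₂ h
    cases h with
    | seq h₁ h₂ =>
      obtain ⟨rfl, rfl⟩ := ih₁ h₁
      obtain ⟨rfl, rfl⟩ := ih₂ h₂
      exact ⟨rfl, rfl⟩
  | iteTrue hb _ ih =>
    intro l s₂ h
    cases h with
    | iteTrue _ h => obtain ⟨rfl, rfl⟩ := ih h; exact ⟨rfl, rfl⟩
    | iteFalse hn => exact absurd hb hn
  | iteFalse hb _ ih =>
    intro l s₂ h
    cases h with
    | iteTrue hp => exact absurd hp hb
    | iteFalse _ h => obtain ⟨rfl, rfl⟩ := ih h; exact ⟨rfl, rfl⟩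
  | whileTrue hb _ _ ih₁ ih₂ =>
    intro l s₂ h
    cases h with
    | whileTrue _ h₁ h₂ =>
      obtain ⟨rfl, rfl⟩ := ih₁ h₁
      obtain ⟨rfl, rfl⟩ := ih₂ h₂
      exact ⟨rfl, rfl⟩
    | whileFalse hn => exact absurd hb hn
  | whileFalse hb =>
    intro l s₂ h
    cases h with
    | whileTrue hp => exact absurd hp hb
    | whileFalse => exact ⟨rfl, rfl⟩

/-- The initial memory. The integer registers `0, 1, 2, 3` hold `n`, `q`, the maximum degree `Δ` and
the number of queried vertices, the real register `0` holds `δ`, and the array `0` holds the list of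
the queried vertices. Everything else is `0`. -/
noncomputable def initState (I : ProbeInput) (δ : ℝ) (query : List (Fin I.n)) : State where
  int x := match x with
    | 0 => (I.n : ℤ)
    | 1 => (I.q : ℤ)
    | 2 => (I.sys.maxDeg : ℤ)
    | 3 => (query.length : ℤ)
    | _ => 0
  real x := match x with
    | 0 => δ
    | _ => 0
  arr a i := match a with
    | 0 => if 0 ≤ i then
        (match query[i.toNat]? with
          | some v => ((v : ℕ) : ℤ)
          | none => 0)
        else 0
    | _ => 0

/-- The program halts on the given instance, query and random array. -/
def Halts (P : Cmd) (I : ProbeInput) (δ : ℝ) (query : List (Fin I.n)) (ω : RandomTape) : Prop :=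
  ∃ k s, Exec I ω P (initState I δ query) k s

/-- The program halts with output `τ ∈ [q]^Λ`: when it halts, cell `v` of the array `1` holds `τ(v)`,
for every `v ∈ Λ`. -/
def Outputs (P : Cmd) (I : ProbeInput) (δ : ℝ) (query : List (Fin I.n)) (ω : RandomTape)
    (Λ : Finset (Fin I.n)) (τ : Λ → Fin I.q) : Prop :=
  ∃ k s, Exec I ω P (initState I δ query) k s ∧
    ∀ v : Λ, s.arr 1 ((v : Fin I.n) : ℕ) = ((τ v : ℕ) : ℤ)

/-- The running time, which is `∞` if the program does not halt. -/
noncomputable def runTime (P : Cmd) (I : ProbeInput) (δ : ℝ) (query : List (Fin I.n))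
    (ω : RandomTape) : ℝ≥0∞ :=
  ⨅ (k : ℕ) (_ : ∃ s, Exec I ω P (initState I δ query) k s), (k : ℝ≥0∞)

end RAM

/-! ### Markov chains driven by the random tape -/

/-! The sampler is recursive rejection sampling in which the proposal is revealed lazily. To sample
the Gibbs distribution of the subsystem induced by a set `W` containing `v`, draw the spin of `v`
from its field, draw the other vertices of `W` from the subsystem induced by `W` without `v` (the
interactions at `v` are ignored), and accept with probability equal to the product of the
interactions between `v` and its neighbours in `W`; on rejection start afresh on `W`. An accepted
configuration has the right law (`SpinSystem.Tractable.sum_field_avg`,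
`SpinSystem.subWeight_eq_erase`).

Every interaction is at least `θ = 1 - (1 - δ) / (2Δ)`, so acceptance can be tested edge by edge
with two coins. The first accepts with probability `θ` without looking at the neighbour. Only when
it fails is the neighbour's spin needed; a recursive call resolves it unless it is already known,
and a second coin with probability `(a - θ) / (1 - θ)` restores the total acceptance probability `a`
of the edge (`Soft.add_recheck`). At every moment the vertices off the trail are still unrevealed
and follow the Gibbs law of the subsystem they induce, with no interaction with the trail.

Exactness is a martingale statement: `value`, the conditional expectation of a test function given
what has been revealed, is preserved by every step (`lintegral_value_step`). The superharmonic half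
bounds each output probability by the marginal. As the sampler halts almost surely and the marginals
sum to one, all these bounds are equalities (`measure_finishesIn`).

For the running time, suppose that a call costs `B` in expectation. A neighbour triggers, with
probability at most `1 - θ`, one recursive call and one restart of the calling vertex, hence `2B`
more. Over at most `Δ` neighbours this amounts to `2Δ(1 - θ)B = (1 - δ)B`, so `δB` need only cover
the direct cost `O(Δ + log q)`. The resulting `potential` is a Foster supersolution
(`lintegral_potential_step`), which gives both almost sure halting and the time bound.

It remains to realize the sampler on the machine with constant cost per step apart from drawing a
spin. A restart forgets a whole segment of resolved vertices. The trail is therefore stored as a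
stack with inverse pointers, so that truncating its length erases the segment and membership is
still tested in constant time. The simulation relation `Sim` then carries every sampler step over to
one pass through the program's loop. -/

instance : IsProbabilityMeasure tapeMeasure := by
  unfold tapeMeasure; infer_instance

namespace TapeChain

open ProbabilityTheory

variable {α : Type*}

/-- The chain that uses cell `t` of the tape in step `t`. -/
def chain (step : α → unitInterval → α) (x₀ : α) : ℕ → RandomTape → α
  | 0, _ => x₀
  | t + 1, ω => step (chain step x₀ t ω) (ω (t : ℤ))

theorem chain_invariant {step : α → unitInterval → α} {x₀ : α} {p : α → Prop} (h₀ : p x₀)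
    (hstep : ∀ x u, p x → p (step x u)) (t : ℕ) (ω : RandomTape) : p (chain step x₀ t ω) := by
  induction t with
  | zero => exact h₀
  | succ t ih => exact hstep _ _ ih

variable [MeasurableSpace α] [DiscreteMeasurableSpace α] [Countable α]

theorem measurable_uncurry_step {step : α → unitInterval → α} (hs : ∀ x, Measurable (step x)) :
    Measurable fun p : α × unitInterval => step p.1 p.2 :=
  measurable_from_prod_countable_right hs

/-- Step `t` reads cell `t` only, so the state at time `t` is a function of the earlier cells. This
is what makes it independent of the next cell to be read. -/
theorem measurable_chain_past {step : α → unitInterval → α} (hs : ∀ x, Measurable (step x))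
    (x₀ : α) (t : ℕ) :
    Measurable[⨆ i ∈ Set.Iio (t : ℤ), MeasurableSpace.comap (fun ω : RandomTape => ω i)
      inferInstance] (chain step x₀ t) := by
  induction t with
  | zero => exact measurable_const
  | succ t ih =>
    have h₁ : Measurable[⨆ i ∈ Set.Iio ((t + 1 : ℕ) : ℤ), MeasurableSpace.comap
        (fun ω : RandomTape => ω i) inferInstance] (chain step x₀ t) :=
      ih.mono (biSup_mono fun i hi => by simp only [Set.mem_Iio] at hi ⊢; omega) le_rfl
    have h₂ : Measurable[⨆ i ∈ Set.Iio ((t + 1 : ℕ) : ℤ), MeasurableSpace.comap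
        (fun ω : RandomTape => ω i) inferInstance] fun ω : RandomTape => ω (t : ℤ) := by
      rw [measurable_iff_comap_le]
      exact le_biSup (fun i : ℤ => MeasurableSpace.comap (fun ω : RandomTape => ω i) inferInstance)
        (show (t : ℤ) ∈ Set.Iio ((t + 1 : ℕ) : ℤ) by simp)
    exact (measurable_uncurry_step hs).comp (h₁.prodMk h₂)

theorem measurable_chain {step : α → unitInterval → α} (hs : ∀ x, Measurable (step x))
    (x₀ : α) (t : ℕ) : Measurable (chain step x₀ t) :=
  (measurable_chain_past hs x₀ t).mono
    (iSup₂_le fun i _ => (measurable_pi_apply i).comap_le) le_rfl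

theorem iIndepFun_cells : iIndepFun (fun (i : ℤ) (ω : RandomTape) => ω i) tapeMeasure :=
  iIndepFun_infinitePi (X := fun _ u => u) fun _ => measurable_id

theorem map_cell (i : ℤ) : tapeMeasure.map (fun ω => ω i) = volume :=
  Measure.infinitePi_map_eval (fun _ : ℤ => (volume : Measure unitInterval)) i

theorem indepFun_chain_cell {step : α → unitInterval → α} (hs : ∀ x, Measurable (step x))
    (x₀ : α) (t : ℕ) :
    IndepFun (chain step x₀ t) (fun ω : RandomTape => ω (t : ℤ)) tapeMeasure := by
  have h := indep_iSup_of_disjoint (fun i : ℤ => (measurable_pi_apply i).comap_le)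
    iIndepFun_cells (S := Set.Iio (t : ℤ)) (T := {(t : ℤ)}) (by simp)
  rw [iSup_singleton] at h
  exact indep_of_indep_of_le_left h (measurable_chain_past hs x₀ t).comap_le

/-- The Markov property: the present state and the fresh cell have a product law, and Tonelli
integrates the cell first. It reduces all later estimates to one-step inequalities at a fixed state.
-/
theorem lintegral_chain_succ {step : α → unitInterval → α} (hs : ∀ x, Measurable (step x))
    (x₀ : α) (t : ℕ) (f : α → ℝ≥0∞) :
    ∫⁻ ω, f (chain step x₀ (t + 1) ω) ∂tapeMeasure =
      ∫⁻ ω, (∫⁻ u, f (step (chain step x₀ t ω) u)) ∂tapeMeasure := by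
  have hf : Measurable f := .of_discrete
  have hm : Measurable fun p : α × unitInterval => f (step p.1 p.2) :=
    hf.comp (measurable_uncurry_step hs)
  have hX := measurable_chain hs x₀ t
  have hc : Measurable fun ω : RandomTape => ω (t : ℤ) := measurable_pi_apply _
  have h := (indepFun_iff_map_prod_eq_prod_map_map hX.aemeasurable hc.aemeasurable).1
    (indepFun_chain_cell hs x₀ t)
  calc ∫⁻ ω, f (chain step x₀ (t + 1) ω) ∂tapeMeasure
      = ∫⁻ p, f (step p.1 p.2)
          ∂(tapeMeasure.map fun ω => (chain step x₀ t ω, ω (t : ℤ))) :=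
        (lintegral_map hm (hX.prodMk hc)).symm
    _ = ∫⁻ x, (∫⁻ u, f (step x u)) ∂(tapeMeasure.map (chain step x₀ t)) := by
        rw [h, map_cell, lintegral_prod _ hm.aemeasurable]
    _ = _ := lintegral_map .of_discrete hX

/-- Foster's inequality: a supersolution bounds the expected accumulated cost. -/
theorem sum_lintegral_cost_le {step : α → unitInterval → α} (hs : ∀ x, Measurable (step x))
    {x₀ : α} {p : α → Prop} (h₀ : p x₀) (hstep : ∀ x u, p x → p (step x u))
    {f c : α → ℝ≥0∞} (hf : ∀ x, p x → c x + ∫⁻ u, f (step x u) ≤ f x) (t : ℕ) :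
    ∑ i ∈ Finset.range t, ∫⁻ ω, c (chain step x₀ i ω) ∂tapeMeasure +
      ∫⁻ ω, f (chain step x₀ t ω) ∂tapeMeasure ≤ f x₀ := by
  induction t with
  | zero => simp [chain]
  | succ t ih =>
    refine le_trans ?_ ih
    rw [Finset.sum_range_succ, add_assoc, lintegral_chain_succ hs]
    gcongr
    rw [← lintegral_add_left]
    · exact lintegral_mono fun ω => hf _ (chain_invariant h₀ hstep t ω)
    · exact (Measurable.of_discrete (f := c)).comp (measurable_chain hs x₀ t)

theorem lintegral_tsum_cost_le {step : α → unitInterval → α} (hs : ∀ x, Measurable (step x))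
    {x₀ : α} {p : α → Prop} (h₀ : p x₀) (hstep : ∀ x u, p x → p (step x u))
    {f c : α → ℝ≥0∞} (hf : ∀ x, p x → c x + ∫⁻ u, f (step x u) ≤ f x) :
    ∫⁻ ω, ∑' t, c (chain step x₀ t ω) ∂tapeMeasure ≤ f x₀ := by
  rw [lintegral_tsum (f := fun t ω => c (chain step x₀ t ω)) fun t =>
    ((Measurable.of_discrete (f := c)).comp (measurable_chain hs x₀ t)).aemeasurable]
  refine ENNReal.tsum_le_of_sum_range_le fun t => ?_
  exact le_trans le_self_add (sum_lintegral_cost_le hs h₀ hstep hf t)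

theorem lintegral_chain_le {step : α → unitInterval → α} (hs : ∀ x, Measurable (step x))
    {x₀ : α} {p : α → Prop} (h₀ : p x₀) (hstep : ∀ x u, p x → p (step x u))
    {f : α → ℝ≥0∞} (hf : ∀ x, p x → ∫⁻ u, f (step x u) ≤ f x) (t : ℕ) :
    ∫⁻ ω, f (chain step x₀ t ω) ∂tapeMeasure ≤ f x₀ := by
  have h := sum_lintegral_cost_le hs h₀ hstep (f := f) (c := 0) (by simpa using hf) t
  simpa using h

/-- If every state outside `D` costs at least one unit, a finite supersolution forces the chain
into `D`. -/
theorem ae_exists_mem {step : α → unitInterval → α} (hs : ∀ x, Measurable (step x))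
    {x₀ : α} {p : α → Prop} (h₀ : p x₀) (hstep : ∀ x u, p x → p (step x u))
    {f c : α → ℝ≥0∞} (hf : ∀ x, p x → c x + ∫⁻ u, f (step x u) ≤ f x) (hfin : f x₀ ≠ ∞)
    {D : Set α} (hD : ∀ x, x ∉ D → 1 ≤ c x) :
    ∀ᵐ ω ∂tapeMeasure, ∃ t, chain step x₀ t ω ∈ D := by
  have hm : Measurable fun ω => ∑' t, c (chain step x₀ t ω) :=
    Measurable.tsum fun t =>
      (Measurable.of_discrete (f := c)).comp (measurable_chain hs x₀ t)
  have h := ae_lt_top hm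
    (ne_top_of_le_ne_top hfin (lintegral_tsum_cost_le hs h₀ hstep hf))
  filter_upwards [h] with ω hω
  by_contra! hne
  refine hω.ne (top_unique ?_)
  calc ∞ = ∑' _ : ℕ, (1 : ℝ≥0∞) := (ENNReal.tsum_const_eq_top_of_ne_zero one_ne_zero).symm
    _ ≤ _ := ENNReal.tsum_le_tsum fun t => hD _ (hne t)

/-- A superharmonic function that is at least one on an absorbing set bounds the probability of
reaching it. -/
theorem measure_exists_mem_le {step : α → unitInterval → α} (hs : ∀ x, Measurable (step x))
    {x₀ : α} {p : α → Prop} (h₀ : p x₀) (hstep : ∀ x u, p x → p (step x u))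
    {f : α → ℝ≥0∞} (hf : ∀ x, p x → ∫⁻ u, f (step x u) ≤ f x)
    {D : Set α} (habs : ∀ x ∈ D, ∀ u, step x u ∈ D) (hD : ∀ x ∈ D, p x → 1 ≤ f x) :
    tapeMeasure {ω | ∃ t, chain step x₀ t ω ∈ D} ≤ f x₀ := by
  have hU : {ω | ∃ t, chain step x₀ t ω ∈ D} = ⋃ t, {ω | chain step x₀ t ω ∈ D} := by
    ext; simp
  have hmono : Monotone fun t => {ω : RandomTape | chain step x₀ t ω ∈ D} :=
    monotone_nat_of_le_succ fun t ω hω => habs _ hω _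
  rw [hU, hmono.measure_iUnion]
  refine iSup_le fun t => le_trans ?_ (lintegral_chain_le hs h₀ hstep hf t)
  have hset : MeasurableSet {ω | chain step x₀ t ω ∈ D} :=
    measurable_chain hs x₀ t (MeasurableSet.of_discrete (s := D))
  rw [← lintegral_indicator_one hset]
  refine lintegral_mono fun ω => ?_
  by_cases hω : chain step x₀ t ω ∈ D
  · rw [Set.indicator_of_mem (by exact hω)]
    exact hD _ hω (chain_invariant h₀ hstep t ω)
  · rw [Set.indicator_of_notMem (by exact hω)]
    exact zero_le

end TapeChain

/-! ### Coins and spins from one uniform number -/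

theorem lintegral_coin {α : Type*} (f : α → ℝ≥0∞) (x y : α) {p : ℝ} (h₀ : 0 ≤ p) (h₁ : p ≤ 1) :
    ∫⁻ u : unitInterval, f (if (u : ℝ) ≤ p then x else y) =
      ENNReal.ofReal p * f x + ENNReal.ofReal (1 - p) * f y := by
  have hm : MeasurableSet {u : unitInterval | (u : ℝ) ≤ p} :=
    measurableSet_le measurable_subtype_coe measurable_const
  have hset : {u : unitInterval | (u : ℝ) ≤ p} = Set.Iic (⟨p, h₀, h₁⟩ : unitInterval) := by
    ext u; simp [← Subtype.coe_le_coe]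
  have hset' : {u : unitInterval | (u : ℝ) ≤ p}ᶜ = Set.Ioi (⟨p, h₀, h₁⟩ : unitInterval) := by
    rw [hset, Set.compl_Iic]
  rw [← lintegral_add_compl _ hm]
  congr 1
  · rw [setLIntegral_congr_fun (g := fun _ => f x) hm, setLIntegral_const, hset,
      unitInterval.volume_Iic, mul_comm]
    intro u hu
    simp only [Set.mem_ofPred_eq] at hu
    simp [hu]
  · rw [setLIntegral_congr_fun (g := fun _ => f y) hm.compl, setLIntegral_const, hset',
      unitInterval.volume_Ioi, mul_comm]
    intro u hu
    simp only [Set.mem_compl_iff, Set.mem_ofPred_eq] at hu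
    simp [hu]

theorem measurable_coin {α : Type*} [MeasurableSpace α] (x y : α) (p : ℝ) :
    Measurable fun u : unitInterval => if (u : ℝ) ≤ p then x else y :=
  Measurable.ite (measurableSet_le measurable_subtype_coe measurable_const)
    measurable_const measurable_const

/-! ### Inverse-transform sampling -/

namespace InverseTransform

variable {q : ℕ}

open Classical in
/-- The number of spins whose cumulative weight is at most `r`. -/
noncomputable def count (p : Fin q → ℝ) (r : ℝ) : ℕ :=
  (Finset.univ.filter fun c : Fin q => ∑ c' ∈ Finset.Iic c, p c' ≤ r).card

/-- The spin drawn with the uniform number `u`, with a default spin for the null event that the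
inverse transform fails. -/
noncomputable def draw [NeZero q] (p : Fin q → ℝ) (u : unitInterval) : Fin q :=
  if h : count p u < q then ⟨count p u, h⟩ else 0

theorem count_lt [NeZero q] {p : Fin q → ℝ} (h₁ : ∑ c, p c = 1) {r : ℝ} (hr : r < 1) :
    count p r < q := by
  classical
  have hlt : (Finset.univ.filter fun c : Fin q => ∑ c' ∈ Finset.Iic c, p c' ≤ r) ⊂
      Finset.univ := by
    refine Finset.filter_ssubset.2 ⟨⊤, Finset.mem_univ _, ?_⟩
    rw [Finset.Iic_top, h₁]
    exact not_le.2 hr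
  simpa [count] using Finset.card_lt_card hlt

theorem draw_val [NeZero q] {p : Fin q → ℝ} (h₁ : ∑ c, p c = 1) {u : unitInterval}
    (hu : (u : ℝ) < 1) : (draw p u : ℕ) = count p u := by
  simp [draw, count_lt h₁ hu]

theorem monotone_count (p : Fin q → ℝ) : Monotone (count p) := fun _ _ h =>
  Finset.card_le_card (Finset.monotone_filter_right _ fun _ _ hc => le_trans hc h)

theorem measurable_draw [NeZero q] (p : Fin q → ℝ) : Measurable (draw p) := by
  have h : Measurable fun u : unitInterval => count p u :=
    (monotone_count p).measurable.comp measurable_subtype_coe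
  exact (Measurable.of_discrete
    (f := fun k : ℕ => if h : k < q then (⟨k, h⟩ : Fin q) else 0)).comp h

/-- Cumulative weights are monotone in the spin, so the spins counted at `u` are exactly those below
`c`, and there are `c` of them. -/
theorem draw_eq [NeZero q] {p : Fin q → ℝ} (h₀ : ∀ c, 0 ≤ p c) (c : Fin q) {u : unitInterval}
    (hl : ∑ c' ∈ Finset.Iio c, p c' ≤ u) (hr : (u : ℝ) < ∑ c' ∈ Finset.Iic c, p c') :
    draw p u = c := by
  classical
  have hcount : count p u = c := by
    rw [count, ← Fin.card_Iio c]
    congr 1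
    ext c'
    simp only [Finset.mem_filter, Finset.mem_univ, true_and, Finset.mem_Iio]
    constructor
    · intro h
      by_contra! hc
      have := Finset.sum_le_sum_of_subset_of_nonneg (Finset.Iic_subset_Iic.2 hc)
        fun i _ _ => h₀ i
      linarith
    · intro h
      refine le_trans (Finset.sum_le_sum_of_subset_of_nonneg ?_ fun i _ _ => h₀ i) hl
      intro i hi
      exact Finset.mem_Iio.2 (lt_of_le_of_lt (Finset.mem_Iic.1 hi) h)
  have : count p u < q := hcount ▸ c.isLt
  simp [draw, hcount]

/-- Each spin is drawn on an interval of length `p c`, which gives one inequality. Both sides sum to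
one, so none of the inequalities is strict and the endpoint `u = 1` needs no separate care. -/
theorem volume_draw_eq [NeZero q] {p : Fin q → ℝ} (h₀ : ∀ c, 0 ≤ p c) (h₁ : ∑ c, p c = 1)
    (c : Fin q) : (volume : Measure unitInterval).real (draw p ⁻¹' {c}) = p c := by
  have hle : ∀ c, p c ≤ (volume : Measure unitInterval).real (draw p ⁻¹' {c}) := by
    intro c
    have hI : ∀ s : Finset (Fin q), ∑ c' ∈ s, p c' ∈ Set.Icc (0 : ℝ) 1 := fun s =>
      ⟨Finset.sum_nonneg fun i _ => h₀ i, h₁ ▸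
        Finset.sum_le_sum_of_subset_of_nonneg (Finset.subset_univ _) fun i _ _ => h₀ i⟩
    have hsub : Set.Ico (⟨_, hI (Finset.Iio c)⟩ : unitInterval) ⟨_, hI (Finset.Iic c)⟩ ⊆
        draw p ⁻¹' {c} := fun u hu =>
      draw_eq h₀ c (Subtype.coe_le_coe.2 hu.1) (Subtype.coe_lt_coe.2 hu.2)
    refine le_trans (le_of_eq ?_) (measureReal_mono hsub)
    have hsum : ∑ c' ∈ Finset.Iic c, p c' = ∑ c' ∈ Finset.Iio c, p c' + p c := by
      rw [← Finset.Iio_insert, Finset.sum_insert (by simp), add_comm]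
    rw [Measure.real, unitInterval.volume_Ico, ENNReal.toReal_ofReal] <;> simp [hsum, h₀ c]
  have hsum : ∑ c, (volume : Measure unitInterval).real (draw p ⁻¹' {c}) = ∑ c, p c := by
    rw [sum_measureReal_preimage_singleton _ fun c _ =>
      measurable_draw p (MeasurableSet.singleton c), h₁]
    simp
  exact ((Finset.sum_eq_sum_iff_of_le fun c _ => hle c).1 hsum.symm c (Finset.mem_univ c)).symm

theorem lintegral_draw [NeZero q] {p : Fin q → ℝ} (h₀ : ∀ c, 0 ≤ p c) (h₁ : ∑ c, p c = 1)
    (f : Fin q → ℝ≥0∞) :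
    ∫⁻ u, f (draw p u) = ∑ c, ENNReal.ofReal (p c) * f c := by
  rw [← lintegral_map (μ := volume) (f := f) .of_discrete (measurable_draw p), lintegral_fintype]
  refine Finset.sum_congr rfl fun c _ => ?_
  rw [Measure.map_apply (measurable_draw p) (MeasurableSet.singleton c), mul_comm,
    ← volume_draw_eq h₀ h₁ c, ofReal_measureReal]

end InverseTransform

/-! ### Gibbs distributions on induced subgraphs -/

namespace SpinSystem

variable {n q : ℕ} (S : SpinSystem n q)

/-- The weight of a configuration in the subsystem induced by `W`. -/
noncomputable def subWeight (W : Finset (Fin n)) (ρ : Fin n → Fin q) : ℝ :=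
  (∏ v ∈ W, S.field v (ρ v)) *
    ∏ p ∈ S.edges with p.1 ∈ W ∧ p.2 ∈ W, S.inter p.1 p.2 (ρ p.1) (ρ p.2)

/-- The total weight in the subsystem induced by `W`, summed over configurations of all vertices. -/
noncomputable def subTotal (W : Finset (Fin n)) : ℝ := ∑ ρ, S.subWeight W ρ

/-- The expectation of `h` when `x` is resampled on `W` from the Gibbs distribution of the subsystem
induced by `W`. -/
noncomputable def avg (W : Finset (Fin n)) (h : (Fin n → Fin q) → ℝ) (x : Fin n → Fin q) : ℝ :=
  (∑ ρ, S.subWeight W ρ * h (W.piecewise ρ x)) / S.subTotal W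

theorem subWeight_congr {W : Finset (Fin n)} {ρ ρ' : Fin n → Fin q} (h : ∀ v ∈ W, ρ v = ρ' v) :
    S.subWeight W ρ = S.subWeight W ρ' := by
  unfold subWeight
  congr 1
  · exact Finset.prod_congr rfl fun v hv => by rw [h v hv]
  · refine Finset.prod_congr rfl fun p hp => ?_
    obtain ⟨-, h₁, h₂⟩ := Finset.mem_filter.1 hp
    rw [h _ h₁, h _ h₂]

theorem subWeight_nonneg (W : Finset (Fin n)) (ρ : Fin n → Fin q) : 0 ≤ S.subWeight W ρ := by
  refine mul_nonneg (Finset.prod_nonneg fun v _ => S.field_nonneg _ _)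
    (Finset.prod_nonneg fun p hp => S.inter_nonneg _ _ ?_ _ _)
  simp only [edges, Finset.mem_filter] at hp
  exact hp.1.2.1

theorem subWeight_univ (ρ : Fin n → Fin q) : S.subWeight Finset.univ ρ = S.weight ρ := by
  simp [subWeight, weight]

/-! ### Averages over an induced subsystem with the remaining vertices frozen -/

variable {S}

section Tractable

variable {δ : ℝ} (hS : S.Tractable δ) (hδ : 0 < δ)
include hS hδ

theorem Tractable.threshold_pos : 0 < 1 - (1 - δ) / (2 * (S.maxDeg : ℝ)) := by
  have h : (1 : ℝ) ≤ S.maxDeg := by exact_mod_cast hS.one_le_maxDeg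
  rw [sub_pos, div_lt_one (by linarith)]
  linarith

theorem Tractable.inter_pos {u v : Fin n} (huv : S.graph.Adj u v) (a b : Fin q) :
    0 < S.inter u v a b :=
  (hS.threshold_pos hδ).trans_le (hS.soft u v huv a b)

/-- A normalized field has a positive entry at every vertex, and all interactions are positive, so
some configuration has positive weight. -/
theorem Tractable.subTotal_pos (W : Finset (Fin n)) : 0 < S.subTotal W := by
  have hc : ∀ v, ∃ c, 0 < S.field v c := by
    intro v
    by_contra! h
    have := Finset.sum_nonpos fun c (_ : c ∈ Finset.univ) => h c
    linarith [hS.field_normalized v]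
  choose ρ hρ using hc
  refine Finset.sum_pos' (fun ρ _ => S.subWeight_nonneg W ρ) ⟨ρ, Finset.mem_univ _, ?_⟩
  refine mul_pos (Finset.prod_pos fun v _ => hρ v) (Finset.prod_pos fun p hp => ?_)
  simp only [edges, Finset.mem_filter] at hp
  exact hS.inter_pos hδ hp.1.2.1 _ _

theorem Tractable.avg_const {W : Finset (Fin n)} {h : (Fin n → Fin q) → ℝ} {x : Fin n → Fin q}
    {c : ℝ} (hc : ∀ σ : Fin n → Fin q, (∀ v ∉ W, σ v = x v) → h σ = c) : S.avg W h x = c := by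
  have hh : ∀ ρ : Fin n → Fin q, h (W.piecewise ρ x) = c := fun ρ =>
    hc _ fun v hv => Finset.piecewise_eq_of_notMem _ _ _ hv
  simp only [avg, hh, ← Finset.sum_mul]
  exact mul_div_cancel_left₀ c (hS.subTotal_pos hδ W).ne'

end Tractable

theorem avg_congr {W : Finset (Fin n)} {h k : (Fin n → Fin q) → ℝ} {x : Fin n → Fin q}
    (hk : ∀ σ : Fin n → Fin q, (∀ v ∉ W, σ v = x v) → h σ = k σ) : S.avg W h x = S.avg W k x := by
  unfold avg
  congr 1
  refine Finset.sum_congr rfl fun ρ _ => ?_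
  rw [hk _ fun v hv => Finset.piecewise_eq_of_notMem _ _ _ hv]

/-- The induced subsystem does not interact with its complement, so the boundary configuration
enters only through the argument of `h`, and only off `W`. -/
theorem avg_congr_boundary {W : Finset (Fin n)} {h : (Fin n → Fin q) → ℝ} {x y : Fin n → Fin q}
    (hxy : ∀ v ∉ W, x v = y v) : S.avg W h x = S.avg W h y := by
  unfold avg
  congr 1
  refine Finset.sum_congr rfl fun ρ _ => ?_
  congr 2
  ext v
  by_cases hv : v ∈ W <;> simp [hv, hxy]

theorem avg_linear {W : Finset (Fin n)} (a b : ℝ) (h k : (Fin n → Fin q) → ℝ) (x : Fin n → Fin q) :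
    S.avg W (fun σ => a * h σ + b * k σ) x = a * S.avg W h x + b * S.avg W k x := by
  simp only [avg, ← mul_div_assoc, ← add_div, Finset.mul_sum, ← Finset.sum_add_distrib]
  congr 1
  exact Finset.sum_congr rfl fun ρ _ => by ring

theorem avg_nonneg {W : Finset (Fin n)} {h : (Fin n → Fin q) → ℝ} (hh : ∀ σ, 0 ≤ h σ)
    (x : Fin n → Fin q) : 0 ≤ S.avg W h x :=
  div_nonneg (Finset.sum_nonneg fun ρ _ => mul_nonneg (S.subWeight_nonneg W ρ) (hh _))
    (Finset.sum_nonneg fun ρ _ => S.subWeight_nonneg W ρ)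

/-- Swapping the free spin `c` with the spin of `ρ` at `v` is an involution of the index set. It
turns a separately drawn spin at `v` into a coordinate of the configuration; the old coordinate
becomes a dummy and contributes the factor `q`. -/
theorem sum_sum_update {M : Type*} [AddCommMonoid M] (v : Fin n)
    (f : Fin q → (Fin n → Fin q) → M) (hf : ∀ c d ρ, f c (Function.update ρ v d) = f c ρ) :
    ∑ c, ∑ ρ, f c ρ = q • ∑ ρ, f (ρ v) ρ := by
  have h : ∑ p : Fin q × (Fin n → Fin q), f p.1 p.2 =
      ∑ p : Fin q × (Fin n → Fin q), f (p.2 v) p.2 := by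
    have hinv : Function.Involutive fun p : Fin q × (Fin n → Fin q) =>
        (p.2 v, Function.update p.2 v p.1) := by
      intro p; simp
    rw [← hinv.bijective.sum_comp]
    exact Finset.sum_congr rfl fun p _ => hf _ _ _
  rw [Fintype.sum_prod_type, Fintype.sum_prod_type] at h
  simpa using h

/-- Rejection sampling in one vertex: drawing the spin of `v` from its field, resampling the rest of
`W`, and starting afresh on `W` with probability `1 - a` amounts to resampling `W`. -/
theorem Tractable.sum_field_avg {δ : ℝ} (hS : S.Tractable δ) (hδ : 0 < δ) {W : Finset (Fin n)}
    {v : Fin n} (hv : v ∈ W) {a : (Fin n → Fin q) → ℝ}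
    (ha : ∀ σ τ : Fin n → Fin q, (∀ u ∈ W, σ u = τ u) → a σ = a τ)
    (hw : ∀ ρ, S.subWeight W ρ = S.field v (ρ v) * S.subWeight (W.erase v) ρ * a ρ)
    (h : (Fin n → Fin q) → ℝ) (x : Fin n → Fin q) :
    ∑ c, S.field v c * S.avg (W.erase v) (fun σ => a σ * h σ + (1 - a σ) * S.avg W h σ)
      (Function.update x v c) = S.avg W h x := by
  -- The accepted part of the proposal is proportional to the Gibbs average on `W`, with a factor
  -- independent of `k`. The `q` appears because both totals sum over configurations of all
  -- vertices, including those outside the subsystem.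
  have key : ∀ k : (Fin n → Fin q) → ℝ,
      ∑ c, S.field v c * S.avg (W.erase v) (fun σ => a σ * k σ) (Function.update x v c) =
        q * (S.subTotal W / S.subTotal (W.erase v)) * S.avg W k x := by
    intro k
    have hpw : ∀ c ρ, (W.erase v).piecewise ρ (Function.update x v c) =
        W.piecewise (Function.update ρ v c) x := by
      intro c ρ
      ext u
      by_cases huv : u = v
      · subst huv; simp [hv]
      · by_cases hu : u ∈ W <;> simp [hu, huv, Finset.piecewise]
    have hpv : ∀ c ρ, a (W.piecewise (Function.update ρ v c) x) = a (Function.update ρ v c) :=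
      fun c ρ => ha _ _ fun u hu => Finset.piecewise_eq_of_mem _ _ _ hu
    have h₁ : ∑ c, ∑ ρ, S.field v c * (S.subWeight (W.erase v) ρ *
        (a (Function.update ρ v c) * k (W.piecewise (Function.update ρ v c) x))) =
        q * ∑ ρ, S.subWeight W ρ * k (W.piecewise ρ x) := by
      rw [sum_sum_update v]
      · rw [nsmul_eq_mul]
        congr 1
        refine Finset.sum_congr rfl fun ρ _ => ?_
        rw [Function.update_eq_self, hw]
        ring
      · intro c d ρ
        rw [Function.update_idem]
        congr 2
        refine S.subWeight_congr fun u hu => ?_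
        rw [Function.update_of_ne (Finset.ne_of_mem_erase hu)]
    simp only [avg, hpw, hpv, mul_div_assoc', Finset.mul_sum, ← Finset.sum_div]
    rw [h₁, Finset.mul_sum]
    have := (hS.subTotal_pos hδ W).ne'
    have := (hS.subTotal_pos hδ (W.erase v)).ne'
    simp only [← Finset.mul_sum]
    field_simp
  -- With `k = 1` the factor is identified as the acceptance probability `p`. The claim then reads
  -- `p * m + (1 - p) * m = m` for `m` the average of `h` on `W`.
  have h₁ := key fun _ => 1
  have h₂ := key h
  rw [hS.avg_const hδ (c := 1) fun _ _ => rfl, mul_one] at h₁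
  simp only [mul_one] at h₁
  have hsplit : ∀ c, S.avg (W.erase v) (fun σ => a σ * h σ + (1 - a σ) * S.avg W h σ)
      (Function.update x v c) =
      S.avg (W.erase v) (fun σ => a σ * h σ) (Function.update x v c) + (S.avg W h x -
        S.avg W h x * S.avg (W.erase v) a (Function.update x v c)) := by
    intro c
    -- The restart value on `W` does not see what was proposed inside `W`, so it leaves the inner
    -- average as a constant.
    have hm : ∀ σ : Fin n → Fin q, (∀ u ∉ W.erase v, σ u = Function.update x v c u) →
        S.avg W h σ = S.avg W h x := by
      intro σ hσ
      refine avg_congr_boundary fun u hu => ?_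
      rw [hσ u fun h => hu (Finset.mem_of_mem_erase h),
        Function.update_of_ne fun h => hu (by rwa [h])]
    have e₁ : S.avg (W.erase v) (fun σ => a σ * h σ + (1 - a σ) * S.avg W h σ)
        (Function.update x v c) = S.avg (W.erase v) (fun σ => 1 * (a σ * h σ) +
          1 * (1 * S.avg W h x + (- S.avg W h x) * a σ)) (Function.update x v c) :=
      avg_congr fun σ hσ => by rw [hm σ hσ]; ring
    rw [e₁, avg_linear, avg_linear, hS.avg_const hδ (c := S.avg W h x) fun _ _ => rfl]
    ring
  simp only [hsplit, mul_add, mul_sub, Finset.sum_add_distrib, Finset.sum_sub_distrib, h₂,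
    ← Finset.sum_mul, hS.field_normalized]
  have h₃ : ∑ c, S.field v c * (S.avg W h x * S.avg (W.erase v) a (Function.update x v c)) =
      S.avg W h x * ∑ c, S.field v c * S.avg (W.erase v) a (Function.update x v c) := by
    rw [Finset.mul_sum]
    exact Finset.sum_congr rfl fun c _ => by ring
  rw [h₃, h₁]
  ring

/-- The interactions of `v` with those of its neighbours from position `i` on that are not in
`below`. -/
noncomputable def scanWeight (adj : AdjacencyList S.graph) (v : Fin n) (below : List (Fin n))
    (i : ℕ) (σ : Fin n → Fin q) : ℝ :=
  (((adj.nbrs v).drop i).map fun u => if u ∈ below then 1 else S.inter v u (σ v) (σ u)).prod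

/-- The edges inside `W` that touch `v` correspond to the neighbours of `v` in `W`; neighbours in
`below` lie outside `W` and count as one. This is the factorization that `Tractable.sum_field_avg`
asks for, with `scanWeight` as acceptance probability. -/
theorem subWeight_eq_erase (adj : AdjacencyList S.graph) {v : Fin n} {below : List (Fin n)}
    (hv : v ∉ below) (ρ : Fin n → Fin q) :
    S.subWeight below.toFinsetᶜ ρ = S.field v (ρ v) * S.subWeight (below.toFinsetᶜ.erase v) ρ *
      scanWeight adj v below 0 ρ := by
  classical
  set W := below.toFinsetᶜ with hW
  have hmem : ∀ u, u ∈ W ↔ u ∉ below := fun u => by simp [hW]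
  have hscan : scanWeight adj v below 0 ρ =
      ∏ u ∈ (adj.nbrs v).toFinset with u ∈ W, S.inter v u (ρ v) (ρ u) := by
    rw [scanWeight, List.drop_zero, ← List.prod_toFinset _ (adj.nodup v), Finset.prod_filter]
    exact Finset.prod_congr rfl fun u _ => by simp [hmem, ite_not]
  have hedge : (∏ p ∈ S.edges with p.1 ∈ W ∧ p.2 ∈ W, S.inter p.1 p.2 (ρ p.1) (ρ p.2)) =
      (∏ p ∈ S.edges with p.1 ∈ W.erase v ∧ p.2 ∈ W.erase v,
        S.inter p.1 p.2 (ρ p.1) (ρ p.2)) *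
      ∏ u ∈ (adj.nbrs v).toFinset with u ∈ W, S.inter v u (ρ v) (ρ u) := by
    rw [← Finset.prod_filter_mul_prod_filter_not _ fun p : Fin n × Fin n => p.1 ≠ v ∧ p.2 ≠ v]
    congr 1
    · refine Finset.prod_congr ?_ fun _ _ => rfl
      ext p
      simp only [Finset.mem_filter, Finset.mem_erase]
      tauto
    · symm
      -- `edges` stores each edge with its smaller endpoint first, while the adjacency list sees it
      -- from `v`; `inter_symm` reconciles the two orientations.
      refine Finset.prod_bij (fun u _ => if v < u then (v, u) else (u, v)) ?_ ?_ ?_ ?_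
      · intro u hu
        simp only [Finset.mem_filter, List.mem_toFinset, adj.mem_nbrs] at hu
        have hne := hu.1.ne
        have hvW : v ∈ W := (hmem v).2 hv
        by_cases hlt : v < u
        · simp [hlt, edges, hu.1, hu.2, hvW]
        · have : u < v := lt_of_le_of_ne (not_lt.1 hlt) hne.symm
          simp [hlt, edges, hu.1.symm, hu.2, hvW, this]
      · intro u hu u' hu' he
        simp only [Finset.mem_filter, List.mem_toFinset, adj.mem_nbrs] at hu hu'
        have hne := hu.1.ne
        have hne' := hu'.1.ne
        by_cases hlt : v < u <;> by_cases hlt' : v < u' <;> simp [hlt, hlt'] at he <;> tauto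
      · intro p hp
        simp only [Finset.mem_filter, edges, Finset.mem_univ, true_and] at hp
        obtain ⟨⟨⟨hadj, hlt⟩, h₁, h₂⟩, h₃⟩ := hp
        by_cases hpv : p.1 = v
        · refine ⟨p.2, ?_, ?_⟩
          · simp only [Finset.mem_filter, List.mem_toFinset, adj.mem_nbrs]
            exact ⟨hpv ▸ hadj, h₂⟩
          · rw [if_pos (hpv ▸ hlt), ← hpv]
        · have hpv' : p.2 = v := by tauto
          refine ⟨p.1, ?_, ?_⟩
          · simp only [Finset.mem_filter, List.mem_toFinset, adj.mem_nbrs]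
            exact ⟨hpv' ▸ hadj.symm, h₁⟩
          · rw [if_neg (not_lt.2 (hpv' ▸ hlt.le)), ← hpv']
      · intro u hu
        simp only [Finset.mem_filter, List.mem_toFinset, adj.mem_nbrs] at hu
        by_cases hlt : v < u
        · simp [hlt]
        · simp [hlt, S.inter_symm v u hu.1]
  rw [hscan, subWeight, hedge, subWeight, ← Finset.mul_prod_erase W _ ((hmem v).2 hv)]
  ring

theorem length_nbrs_le (adj : AdjacencyList S.graph) (v : Fin n) :
    (adj.nbrs v).length ≤ S.maxDeg := by
  classical
  have h : (adj.nbrs v).toFinset = S.graph.neighborFinset v := by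
    ext u; simp [adj.mem_nbrs]
  rw [← List.toFinset_card_of_nodup (adj.nodup v), h, SimpleGraph.card_neighborFinset_eq_degree]
  unfold maxDeg
  convert S.graph.degree_le_maxDegree v

end SpinSystem

/-! ### The lazy sampler -/

namespace LazySampler

/-- A call that resolves `vertex`: `below` lists the vertices resolved before the call, and `idx` is
the position in the adjacency list that the call has reached. -/
structure Frame (n : ℕ) where
  vertex : Fin n
  below : List (Fin n)
  idx : ℕ
deriving Countable

/-- The states of the sampler: `val` holds the spins, `queue` the remaining queries, `trail` the
vertices resolved or being resolved, latest first, and the frames the stack of calls, top first. -/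
inductive Conf (n q : ℕ)
  | idle (val : Fin n → Fin q) (queue trail : List (Fin n))
  | fresh (val : Fin n → Fin q) (queue : List (Fin n)) (f : Frame n) (fs : List (Frame n))
  | scan (val : Fin n → Fin q) (queue trail : List (Fin n)) (f : Frame n) (fs : List (Frame n))
  | check (val : Fin n → Fin q) (queue trail : List (Fin n)) (f : Frame n) (fs : List (Frame n))
  | done (val : Fin n → Fin q) (trail : List (Fin n))

theorem Conf.countable_aux {n q : ℕ} : Countable (Conf n q) := by
  let e : Conf n q → ℕ × (Fin n → Fin q) × List (Fin n) × List (Fin n) × List (Frame n)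
    | .idle x l T => (0, x, l, T, [])
    | .fresh x l f fs => (1, x, l, [], f :: fs)
    | .scan x l T f fs => (2, x, l, T, f :: fs)
    | .check x l T f fs => (3, x, l, T, f :: fs)
    | .done x T => (4, x, [], T, [])
  refine Function.Injective.countable (f := e) ?_
  intro a b h
  cases a <;> cases b <;> simp_all [e]

instance {n q : ℕ} : Countable (Conf n q) := Conf.countable_aux

instance {n q : ℕ} : MeasurableSpace (Conf n q) := ⊤

instance {n q : ℕ} : DiscreteMeasurableSpace (Conf n q) := ⟨fun _ => trivial⟩

variable {n q : ℕ} {S : SpinSystem n q} (adj : AdjacencyList S.graph)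

/-- The probability that the second coin accepts an edge with interaction `a` when the first coin
has exceeded `θ`. -/
noncomputable def recheck (θ a : ℝ) : ℝ := (a - θ) / (1 - θ)

/-- The state after a frame has returned to the stack `fs`. -/
def popped (x : Fin n → Fin q) (l T : List (Fin n)) : List (Frame n) → Conf n q
  | [] => .idle x l T
  | f :: fs => .check x l T f fs

/-- One step of the sampler, driven by one uniform number. -/
noncomputable def step [NeZero q] (θ : ℝ) : Conf n q → unitInterval → Conf n q
  | .idle x [] T, _ => .done x T
  | .idle x (v :: l) T, _ => if v ∈ T then .idle x l T else .fresh x l ⟨v, T, 0⟩ []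
  | .fresh x l f fs, u =>
      .scan (Function.update x f.vertex (InverseTransform.draw (S.field f.vertex) u)) l
        (f.vertex :: f.below) { f with idx := 0 } fs
  | .scan x l T f fs, u =>
      match (adj.nbrs f.vertex)[f.idx]? with
      | none => popped x l T fs
      | some w =>
          if w ∈ f.below then .scan x l T { f with idx := f.idx + 1 } fs
          else if (u : ℝ) ≤ θ then .scan x l T { f with idx := f.idx + 1 } fs
          else if w ∈ T then .check x l T f fs
          else .fresh x l ⟨w, T, 0⟩ (f :: fs)
  | .check x l T f fs, u =>
      match (adj.nbrs f.vertex)[f.idx]? with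
      | none => .done x T
      | some w =>
          if (u : ℝ) ≤ recheck θ (S.inter f.vertex w (x f.vertex) (x w)) then
            .scan x l T { f with idx := f.idx + 1 } fs
          else .fresh x l f fs
  | .done x T, _ => .done x T

/-! ### One-step equations of the sampler -/

section StepEquations

variable [NeZero q] {θ : ℝ} {x : Fin n → Fin q} {l T : List (Fin n)} {f : Frame n}
  {fs : List (Frame n)} {u : unitInterval}

theorem step_idle_nil : step adj θ (.idle x [] T) u = .done x T := rfl

theorem step_idle_cons {v : Fin n} : step adj θ (.idle x (v :: l) T) u =
    if v ∈ T then .idle x l T else .fresh x l ⟨v, T, 0⟩ [] := rfl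

theorem step_fresh : step adj θ (.fresh x l f fs) u =
    .scan (Function.update x f.vertex (InverseTransform.draw (S.field f.vertex) u)) l
      (f.vertex :: f.below) { f with idx := 0 } fs := rfl

theorem step_scan_none (h : (adj.nbrs f.vertex)[f.idx]? = none) :
    step adj θ (.scan x l T f fs) u = popped x l T fs := by
  simp only [step, h]

theorem step_scan_some {w : Fin n} (h : (adj.nbrs f.vertex)[f.idx]? = some w) :
    step adj θ (.scan x l T f fs) u =
      if w ∈ f.below then .scan x l T { f with idx := f.idx + 1 } fs
      else if (u : ℝ) ≤ θ then .scan x l T { f with idx := f.idx + 1 } fs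
      else if w ∈ T then .check x l T f fs
      else .fresh x l ⟨w, T, 0⟩ (f :: fs) := by
  simp only [step, h]

theorem step_check_none (h : (adj.nbrs f.vertex)[f.idx]? = none) :
    step adj θ (.check x l T f fs) u = .done x T := by
  simp only [step, h]

theorem step_check_some {w : Fin n} (h : (adj.nbrs f.vertex)[f.idx]? = some w) :
    step adj θ (.check x l T f fs) u =
      if (u : ℝ) ≤ recheck θ (S.inter f.vertex w (x f.vertex) (x w)) then
        .scan x l T { f with idx := f.idx + 1 } fs
      else .fresh x l f fs := by
  simp only [step, h]

end StepEquations

theorem measurable_step [NeZero q] (θ : ℝ) (X : Conf n q) : Measurable (step adj θ X) := by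
  cases X with
  | idle x l T => cases l <;> exact measurable_const
  | fresh x l f fs =>
    exact (Measurable.of_discrete (f := fun c => Conf.scan (Function.update x f.vertex c) l
      (f.vertex :: f.below) { f with idx := 0 } fs)).comp
      (InverseTransform.measurable_draw (S.field f.vertex))
  | scan x l T f fs =>
    cases h : (adj.nbrs f.vertex)[f.idx]? with
    | none =>
      rw [show step adj θ (.scan x l T f fs) = _ from funext fun u => step_scan_none adj h]
      exact measurable_const
    | some w =>
      rw [show step adj θ (.scan x l T f fs) = _ from funext fun u => step_scan_some adj h]
      by_cases hw : w ∈ f.below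
      · simp only [hw, if_true]
        exact measurable_const
      · simp only [hw, if_false]
        exact measurable_coin _ _ _
  | check x l T f fs =>
    cases h : (adj.nbrs f.vertex)[f.idx]? with
    | none =>
      rw [show step adj θ (.check x l T f fs) = _ from funext fun u => step_check_none adj h]
      exact measurable_const
    | some w =>
      rw [show step adj θ (.check x l T f fs) = _ from funext fun u => step_check_some adj h]
      exact measurable_coin _ _ _
  | done x T => exact measurable_const

/-! #### Invariants -/

/-- A well-formed stack of calls: each call was made by the one below it, and the bottom one was
made for a query. -/
def StackOK (Λ : Finset (Fin n)) (l : List (Fin n)) : Frame n → List (Frame n) → Prop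
  | f, [] => f.vertex ∉ f.below ∧ ∀ v ∈ Λ, v ∈ l ∨ v ∈ f.vertex :: f.below
  | f, f' :: fs => f.vertex ∉ f.below ∧ (adj.nbrs f'.vertex)[f'.idx]? = some f.vertex ∧
      (f'.vertex :: f'.below) <:+ f.below ∧ StackOK Λ l f' fs

theorem StackOK.notMem {adj : AdjacencyList S.graph} {Λ : Finset (Fin n)} {l : List (Fin n)}
    {f : Frame n} {fs : List (Frame n)} (h : StackOK adj Λ l f fs) : f.vertex ∉ f.below := by
  cases fs <;> exact h.1

theorem StackOK.setIdx {adj : AdjacencyList S.graph} {Λ : Finset (Fin n)} {l : List (Fin n)}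
    {f : Frame n} {fs : List (Frame n)} (h : StackOK adj Λ l f fs) (i : ℕ) :
    StackOK adj Λ l { f with idx := i } fs := by
  cases fs <;> exact h

/-- The invariants of the reachable states. -/
def Inv (Λ : Finset (Fin n)) : Conf n q → Prop
  | .idle _ l T => ∀ v ∈ Λ, v ∈ l ∨ v ∈ T
  | .fresh _ l f fs => StackOK adj Λ l f fs
  | .scan _ l T f fs => StackOK adj Λ l f fs ∧ (f.vertex :: f.below) <:+ T
  | .check _ l T f fs => StackOK adj Λ l f fs ∧ (f.vertex :: f.below) <:+ T ∧
      ∃ w ∈ T, (adj.nbrs f.vertex)[f.idx]? = some w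
  | .done _ T => ∀ v ∈ Λ, v ∈ T

/-- The vertex of the returning call is the very neighbour at which its caller waits, and it is now
on the trail. Hence the second coin never meets an unresolved neighbour, and the fallback branch of
`check` is unreachable. -/
theorem inv_popped {adj : AdjacencyList S.graph} {Λ : Finset (Fin n)} {x : Fin n → Fin q}
    {l T : List (Fin n)} {f : Frame n} {fs : List (Frame n)} (h : StackOK adj Λ l f fs)
    (hT : (f.vertex :: f.below) <:+ T) : Inv adj Λ (popped x l T fs) := by
  cases fs with
  | nil => exact fun v hv => (h.2 v hv).imp_right fun hm => hT.subset hm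
  | cons f' fs =>
    obtain ⟨-, hi, hb, h'⟩ := h
    exact ⟨h', (hb.trans (List.suffix_cons _ _)).trans hT, f.vertex,
      hT.subset (List.mem_cons_self), hi⟩

theorem inv_step [NeZero q] (θ : ℝ) (Λ : Finset (Fin n)) (X : Conf n q) (u : unitInterval)
    (hX : Inv adj Λ X) : Inv adj Λ (step adj θ X u) := by
  cases X with
  | idle x l T =>
    cases l with
    | nil => exact fun v hv => (hX v hv).resolve_left (by simp)
    | cons w l =>
      rw [step_idle_cons]
      split_ifs with hw
      · intro v hv
        rcases hX v hv with h | h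
        · rcases List.mem_cons.1 h with rfl | h
          · exact .inr hw
          · exact .inl h
        · exact .inr h
      · refine ⟨hw, fun v hv => ?_⟩
        rcases hX v hv with h | h
        · rcases List.mem_cons.1 h with rfl | h
          · exact .inr (List.mem_cons_self)
          · exact .inl h
        · exact .inr (List.mem_cons_of_mem _ h)
  | fresh x l f fs => exact ⟨StackOK.setIdx hX 0, List.suffix_rfl⟩
  | scan x l T f fs =>
    obtain ⟨hs, hT⟩ := hX
    cases hw : (adj.nbrs f.vertex)[f.idx]? with
    | none =>
      rw [step_scan_none adj hw]
      exact inv_popped hs hT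
    | some w =>
      rw [step_scan_some adj hw]
      split_ifs with h₁ h₂ h₃
      · exact ⟨hs.setIdx _, hT⟩
      · exact ⟨hs.setIdx _, hT⟩
      · exact ⟨hs, hT, w, h₃, hw⟩
      · exact ⟨h₃, hw, hT, hs⟩
  | check x l T f fs =>
    obtain ⟨hs, hT, w, hw, hi⟩ := hX
    rw [step_check_some adj hi]
    split_ifs
    · exact ⟨hs.setIdx _, hT⟩
    · exact hs
  | done x T => exact hX

/-! #### Exactness -/

/-- The probability that a call with configuration `σ` accepts from its present position on, where
the current edge is decided by the second coin alone. -/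
noncomputable def waitWeight (θ : ℝ) (f : Frame n) (σ : Fin n → Fin q) : ℝ :=
  (match (adj.nbrs f.vertex)[f.idx]? with
    | none => 1
    | some w => recheck θ (S.inter f.vertex w (σ f.vertex) (σ w))) *
  SpinSystem.scanWeight adj f.vertex f.below (f.idx + 1) σ

/-- The expectation of `g` at the end, given that the stack `fs` waits for a call that will return
with configuration `σ`. -/
noncomputable def stackValue (θ : ℝ) (g : (Fin n → Fin q) → ℝ) :
    List (Frame n) → (Fin n → Fin q) → ℝ
  | [], σ => g σ
  | f :: fs, σ => waitWeight adj θ f σ * stackValue θ g fs σ +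
      (1 - waitWeight adj θ f σ) * S.avg f.below.toFinsetᶜ (stackValue θ g fs) σ

/-- The expectation of `g` when the top call scans its neighbours. -/
noncomputable def scanValue (θ : ℝ) (g : (Fin n → Fin q) → ℝ) (f : Frame n) (fs : List (Frame n))
    (σ : Fin n → Fin q) : ℝ :=
  SpinSystem.scanWeight adj f.vertex f.below f.idx σ * stackValue adj θ g fs σ +
    (1 - SpinSystem.scanWeight adj f.vertex f.below f.idx σ) *
      S.avg f.below.toFinsetᶜ (stackValue adj θ g fs) σ

/-- The expectation of `g` at the final configuration of all vertices. -/
noncomputable def value (θ : ℝ) (g : (Fin n → Fin q) → ℝ) : Conf n q → ℝ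
  | .idle x _ T => S.avg T.toFinsetᶜ g x
  | .fresh x _ f fs => S.avg f.below.toFinsetᶜ (stackValue adj θ g fs) x
  | .scan x _ T f fs => S.avg T.toFinsetᶜ (scanValue adj θ g f fs) x
  | .check x _ T f fs => S.avg T.toFinsetᶜ (stackValue adj θ g (f :: fs)) x
  | .done x T => S.avg T.toFinsetᶜ g x

/-- The interactions lie between `θ` and `1`. -/
structure Soft (S : SpinSystem n q) (θ : ℝ) : Prop where
  pos : 0 < θ
  le_one : θ ≤ 1
  le_inter : ∀ u v, S.graph.Adj u v → ∀ a b, θ ≤ S.inter u v a b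
  inter_le : ∀ u v, S.graph.Adj u v → ∀ a b, S.inter u v a b ≤ 1

theorem adj_of_getElem? {adj : AdjacencyList S.graph} {v w : Fin n} {i : ℕ}
    (h : (adj.nbrs v)[i]? = some w) : S.graph.Adj v w :=
  (adj.mem_nbrs v w).1 (List.mem_of_getElem? h)

/-! ### Acceptance probabilities lie in the unit interval, and values are nonnegative -/

section Bounds

variable {adj : AdjacencyList S.graph} {θ : ℝ} (hθ : Soft S θ)
include hθ

theorem Soft.recheck_mem {u v : Fin n} (huv : S.graph.Adj u v) (a b : Fin q) :
    recheck θ (S.inter u v a b) ∈ Set.Icc (0 : ℝ) 1 := by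
  have h₁ := hθ.le_inter u v huv a b
  have h₂ := hθ.inter_le u v huv a b
  have h₃ := hθ.le_one
  exact ⟨div_nonneg (by linarith) (by linarith), div_le_one_of_le₀ (by linarith) (by linarith)⟩

/-- The two coins together accept with exactly the probability of the interaction. For `θ = 1` the
quotient in `recheck` is `0 / 0 = 0`, which is harmless: the interaction is then squeezed to one. -/
theorem Soft.add_recheck {u v : Fin n} (huv : S.graph.Adj u v) (a b : Fin q) :
    θ + (1 - θ) * recheck θ (S.inter u v a b) = S.inter u v a b := by
  have h₁ := hθ.le_inter u v huv a b
  have h₂ := hθ.inter_le u v huv a b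
  rcases hθ.le_one.eq_or_lt with h | h
  · subst h; linarith
  · rw [recheck, mul_div_cancel₀ _ (by linarith : (1 - θ) ≠ 0)]
    ring

theorem Soft.scanWeight_mem (v : Fin n) (below : List (Fin n)) (i : ℕ) (σ : Fin n → Fin q) :
    SpinSystem.scanWeight adj v below i σ ∈ Set.Icc (0 : ℝ) 1 := by
  have hl : ∀ m : List (Fin n), (∀ u ∈ m, S.graph.Adj v u) →
      (m.map fun u => if u ∈ below then 1 else S.inter v u (σ v) (σ u)).prod ∈
        Set.Icc (0 : ℝ) 1 := by
    intro m hm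
    induction m with
    | nil => simp
    | cons w m ih =>
      obtain ⟨h₀, h₁⟩ := ih fun u hu => hm u (List.mem_cons_of_mem _ hu)
      have hw := hm w List.mem_cons_self
      have hc : (if w ∈ below then 1 else S.inter v w (σ v) (σ w)) ∈ Set.Icc (0 : ℝ) 1 := by
        split_ifs
        · simp
        · exact ⟨hθ.pos.le.trans (hθ.le_inter v w hw _ _), hθ.inter_le v w hw _ _⟩
      rw [List.map_cons, List.prod_cons]
      exact ⟨mul_nonneg hc.1 h₀, mul_le_one₀ hc.2 h₀ h₁⟩
  exact hl _ fun u hu => (adj.mem_nbrs v u).1 (List.mem_of_mem_drop hu)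

theorem Soft.waitWeight_mem (f : Frame n) (σ : Fin n → Fin q) :
    waitWeight adj θ f σ ∈ Set.Icc (0 : ℝ) 1 := by
  have hs := hθ.scanWeight_mem (adj := adj) f.vertex f.below (f.idx + 1) σ
  unfold waitWeight
  cases h : (adj.nbrs f.vertex)[f.idx]? with
  | none => simpa using hs
  | some w =>
    have hr := hθ.recheck_mem (adj_of_getElem? h) (σ f.vertex) (σ w)
    exact ⟨mul_nonneg hr.1 hs.1, mul_le_one₀ hr.2 hs.1 hs.2⟩

theorem Soft.stackValue_nonneg {g : (Fin n → Fin q) → ℝ} (hg : ∀ σ, 0 ≤ g σ)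
    (fs : List (Frame n)) (σ : Fin n → Fin q) : 0 ≤ stackValue adj θ g fs σ := by
  induction fs generalizing σ with
  | nil => exact hg σ
  | cons f fs ih =>
    have h := hθ.waitWeight_mem (adj := adj) f σ
    exact add_nonneg (mul_nonneg h.1 (ih σ))
      (mul_nonneg (sub_nonneg.2 h.2) (SpinSystem.avg_nonneg ih σ))

theorem Soft.scanValue_nonneg {g : (Fin n → Fin q) → ℝ} (hg : ∀ σ, 0 ≤ g σ) (f : Frame n)
    (fs : List (Frame n)) (σ : Fin n → Fin q) : 0 ≤ scanValue adj θ g f fs σ := by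
  have h := hθ.scanWeight_mem (adj := adj) f.vertex f.below f.idx σ
  have hv := hθ.stackValue_nonneg (adj := adj) hg fs
  exact add_nonneg (mul_nonneg h.1 (hv σ))
    (mul_nonneg (sub_nonneg.2 h.2) (SpinSystem.avg_nonneg hv σ))

theorem Soft.value_nonneg {g : (Fin n → Fin q) → ℝ} (hg : ∀ σ, 0 ≤ g σ) (X : Conf n q) :
    0 ≤ value adj θ g X := by
  cases X with
  | idle x l T => exact SpinSystem.avg_nonneg hg _
  | fresh x l f fs => exact SpinSystem.avg_nonneg (hθ.stackValue_nonneg hg _) _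
  | scan x l T f fs => exact SpinSystem.avg_nonneg (hθ.scanValue_nonneg hg _ _) _
  | check x l T f fs => exact SpinSystem.avg_nonneg (hθ.stackValue_nonneg hg _) _
  | done x T => exact SpinSystem.avg_nonneg hg _

/-- The expectation of a nonnegative function of a coin flip. -/
theorem Soft.lintegral_value_coin {g : (Fin n → Fin q) → ℝ} (hg : ∀ σ, 0 ≤ g σ)
    (X Y : Conf n q) {p : ℝ} (h₀ : 0 ≤ p) (h₁ : p ≤ 1) :
    ∫⁻ u : unitInterval, ENNReal.ofReal (value adj θ g (if (u : ℝ) ≤ p then X else Y)) =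
      ENNReal.ofReal (p * value adj θ g X + (1 - p) * value adj θ g Y) := by
  have hX := hθ.value_nonneg (adj := adj) hg X
  have hY := hθ.value_nonneg (adj := adj) hg Y
  rw [lintegral_coin (fun X => ENNReal.ofReal (value adj θ g X)) X Y h₀ h₁,
    ENNReal.ofReal_add (mul_nonneg h₀ hX) (mul_nonneg (sub_nonneg.2 h₁) hY),
    ENNReal.ofReal_mul h₀, ENNReal.ofReal_mul (sub_nonneg.2 h₁)]

end Bounds

theorem scanWeight_of_getElem?_none {v : Fin n} {i : ℕ} (h : (adj.nbrs v)[i]? = none)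
    (below : List (Fin n)) (σ : Fin n → Fin q) : SpinSystem.scanWeight adj v below i σ = 1 := by
  rw [SpinSystem.scanWeight, List.drop_eq_nil_of_le (List.getElem?_eq_none_iff.1 h)]
  simp

theorem scanWeight_of_getElem?_some {v w : Fin n} {i : ℕ} (h : (adj.nbrs v)[i]? = some w)
    (below : List (Fin n)) (σ : Fin n → Fin q) : SpinSystem.scanWeight adj v below i σ =
      (if w ∈ below then 1 else S.inter v w (σ v) (σ w)) *
        SpinSystem.scanWeight adj v below (i + 1) σ := by
  obtain ⟨hi, rfl⟩ := List.getElem?_eq_some_iff.1 h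
  rw [SpinSystem.scanWeight, List.drop_eq_getElem_cons hi, List.map_cons, List.prod_cons,
    SpinSystem.scanWeight]

theorem value_popped {θ : ℝ} {g : (Fin n → Fin q) → ℝ} (x : Fin n → Fin q) (l T : List (Fin n))
    (fs : List (Frame n)) : value adj θ g (popped x l T fs) =
      S.avg T.toFinsetᶜ (stackValue adj θ g fs) x := by
  cases fs <;> rfl

/-- The martingale property. A fresh draw is one round of rejection sampling; a scan step splits an
interaction into its two coins; a second coin depends only on spins already on the trail and so
commutes with averaging over the rest. Calling a new vertex merely renames the same conditional law.
-/
theorem lintegral_value_step [NeZero q] {δ θ : ℝ} (hS : S.Tractable δ) (hδ : 0 < δ)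
    (hθ : Soft S θ) {g : (Fin n → Fin q) → ℝ} (hg : ∀ σ, 0 ≤ g σ) {Λ : Finset (Fin n)}
    {X : Conf n q} (hX : Inv adj Λ X) :
    ∫⁻ u, ENNReal.ofReal (value adj θ g (step adj θ X u)) = ENNReal.ofReal (value adj θ g X) := by
  cases X with
  | idle x l T =>
    cases l with
    | nil => simp [step_idle_nil, value]
    | cons w l =>
      simp only [step_idle_cons]
      split_ifs <;> simp [value, stackValue]
  | fresh x l f fs =>
    simp only [step_fresh]
    rw [InverseTransform.lintegral_draw (S.field_nonneg f.vertex) (hS.field_normalized f.vertex)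
      fun c => ENNReal.ofReal (value adj θ g (.scan (Function.update x f.vertex c) l
        (f.vertex :: f.below) { f with idx := 0 } fs))]
    simp only [← ENNReal.ofReal_mul (S.field_nonneg _ _)]
    rw [← ENNReal.ofReal_sum_of_nonneg fun c _ =>
      mul_nonneg (S.field_nonneg _ _) (hθ.value_nonneg hg _)]
    congr 1
    have hW : (f.vertex :: f.below).toFinsetᶜ = f.below.toFinsetᶜ.erase f.vertex := by
      ext u; simp
    simp only [value, hW]
    refine hS.sum_field_avg hδ (W := f.below.toFinsetᶜ)
      (by simpa using StackOK.notMem hX) ?_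
      (SpinSystem.subWeight_eq_erase adj (StackOK.notMem hX)) (stackValue adj θ g fs) x
    intro σ τ hστ
    unfold SpinSystem.scanWeight
    congr 1
    refine List.map_congr_left fun u _ => ?_
    split_ifs with hu
    · rfl
    · rw [hστ u (by simpa using hu), hστ f.vertex (by simpa using StackOK.notMem hX)]
  | scan x l T f fs =>
    cases hw : (adj.nbrs f.vertex)[f.idx]? with
    | none =>
      simp only [step_scan_none adj hw, lintegral_const, measure_univ, mul_one, value_popped]
      congr 1
      refine SpinSystem.avg_congr fun σ _ => ?_
      simp [scanValue, scanWeight_of_getElem?_none adj hw]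
    | some w =>
      simp only [step_scan_some adj hw]
      by_cases hb : w ∈ f.below
      · simp only [hb, if_true, lintegral_const, measure_univ, mul_one]
        congr 1
        refine SpinSystem.avg_congr fun σ _ => ?_
        simp [scanValue, scanWeight_of_getElem?_some adj hw, hb]
      · simp only [hb, if_false]
        rw [hθ.lintegral_value_coin hg _ _ hθ.pos.le hθ.le_one]
        congr 1
        -- Whether the neighbour is known or has yet to be resolved, the vertices off `T` have the
        -- same law, so both successors have the same value.
        have hY : value adj θ g (if w ∈ T then .check x l T f fs
            else .fresh x l ⟨w, T, 0⟩ (f :: fs)) =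
            S.avg T.toFinsetᶜ (stackValue adj θ g (f :: fs)) x := by
          split_ifs <;> rfl
        rw [hY]
        simp only [value]
        rw [← SpinSystem.avg_linear]
        refine SpinSystem.avg_congr fun σ _ => ?_
        have ha := hθ.add_recheck (adj_of_getElem? hw) (σ f.vertex) (σ w)
        simp only [scanValue, stackValue, waitWeight, scanWeight_of_getElem?_some adj hw, hw, hb,
          if_false]
        linear_combination (SpinSystem.scanWeight adj f.vertex f.below (f.idx + 1) σ *
          (stackValue adj θ g fs σ - S.avg f.below.toFinsetᶜ (stackValue adj θ g fs) σ)) * ha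
  | check x l T f fs =>
    obtain ⟨hs, hT, w, hwT, hw⟩ := hX
    have hr := hθ.recheck_mem (adj_of_getElem? hw) (x f.vertex) (x w)
    simp only [step_check_some adj hw]
    rw [hθ.lintegral_value_coin hg _ _ hr.1 hr.2]
    congr 1
    simp only [value]
    -- The restart value is written as a constant under the average over the complement of `T`, so
    -- that acceptance and rejection combine under a single average. Every configuration involved
    -- agrees with `x` on `T`, which fixes both spins of the current edge.
    have hm : S.avg f.below.toFinsetᶜ (stackValue adj θ g fs) x =
        S.avg T.toFinsetᶜ (fun _ => S.avg f.below.toFinsetᶜ (stackValue adj θ g fs) x) x :=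
      (hS.avg_const hδ fun _ _ => rfl).symm
    rw [hm, ← SpinSystem.avg_linear]
    refine SpinSystem.avg_congr fun σ hσ => ?_
    have hσT : ∀ v ∈ T, σ v = x v := fun v hv => hσ v (by simpa using hv)
    have hv := hσT _ (hT.subset List.mem_cons_self)
    have hb : S.avg f.below.toFinsetᶜ (stackValue adj θ g fs) σ =
        S.avg f.below.toFinsetᶜ (stackValue adj θ g fs) x :=
      SpinSystem.avg_congr_boundary fun v hv =>
        hσT v (hT.subset (List.mem_cons_of_mem _ (by simpa using hv)))
    simp only [scanValue, stackValue, waitWeight, hw, hv, hσT w hwT, hb]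
    ring
  | done x T => simp [step, value]

/-! #### Running time -/

/-- Bounds on the cost of one step: `C` for a step, and `L` more for drawing a spin. -/
def stepCost (C L : ℝ) : Conf n q → ℝ
  | .idle .. => C
  | .fresh .. => C + L
  | .scan .. => C
  | .check .. => C
  | .done .. => 0

/-- The expected cost of processing one neighbour, if a call costs `B`. -/
def nbrPotential (θ C B : ℝ) : ℝ := C + (1 - θ) * (C + 2 * B)

/-- A bound on the expected cost of the remaining scan from position `i` of `v`. -/
def scanPotential (θ C B : ℝ) (v : Fin n) (i : ℕ) : ℝ :=
  C + ((adj.nbrs v).length - i : ℕ) * nbrPotential θ C B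

/-- A bound on the expected cost of the calls on the stack that wait for a second coin. -/
def stackPotential (θ C B : ℝ) : List (Frame n) → ℝ
  | [] => 0
  | f :: fs => C + B + scanPotential adj θ C B f.vertex (f.idx + 1) + stackPotential θ C B fs

/-- A bound on the expected cost of the remaining queries. -/
def queuePotential (C B : ℝ) (l : List (Fin n)) : ℝ := C + l.length * (C + B)

/-- A bound on the expected remaining running time. -/
def potential (θ C B : ℝ) : Conf n q → ℝ
  | .idle _ l _ => queuePotential C B l
  | .fresh _ l _ fs => B + stackPotential adj θ C B fs + queuePotential C B l
  | .scan _ l _ f fs => scanPotential adj θ C B f.vertex f.idx + stackPotential adj θ C B fs +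
      queuePotential C B l
  | .check _ l _ f fs => stackPotential adj θ C B (f :: fs) + queuePotential C B l
  | .done .. => 0

section Potential

variable {adj} {θ C B : ℝ} (h₁ : θ ≤ 1) (hC : 0 ≤ C) (hB : 0 ≤ B)
include h₁ hC hB

theorem nbrPotential_nonneg : 0 ≤ nbrPotential θ C B :=
  add_nonneg hC (mul_nonneg (by linarith) (by linarith))

theorem scanPotential_nonneg (v : Fin n) (i : ℕ) : 0 ≤ scanPotential adj θ C B v i :=
  add_nonneg hC (mul_nonneg (Nat.cast_nonneg _) (nbrPotential_nonneg h₁ hC hB))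

theorem stackPotential_nonneg (fs : List (Frame n)) : 0 ≤ stackPotential adj θ C B fs := by
  induction fs with
  | nil => exact le_rfl
  | cons f fs ih =>
    have := scanPotential_nonneg (adj := adj) h₁ hC hB f.vertex (f.idx + 1)
    simp only [stackPotential]
    linarith

omit h₁ in
theorem queuePotential_nonneg (l : List (Fin n)) : 0 ≤ queuePotential C B l :=
  add_nonneg hC (mul_nonneg (Nat.cast_nonneg _) (by linarith))

theorem potential_nonneg (X : Conf n q) : 0 ≤ potential adj θ C B X := by
  have hq := queuePotential_nonneg (n := n) hC hB
  have hs := stackPotential_nonneg (adj := adj) h₁ hC hB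
  cases X with
  | idle x l T => exact hq l
  | fresh x l f fs => exact add_nonneg (add_nonneg hB (hs fs)) (hq l)
  | scan x l T f fs =>
    exact add_nonneg (add_nonneg (scanPotential_nonneg h₁ hC hB _ _) (hs fs)) (hq l)
  | check x l T f fs => exact add_nonneg (hs _) (hq l)
  | done x T => exact le_rfl

theorem ofReal_add_potential_coin_le {c r p : ℝ} (hc : 0 ≤ c) (hp₀ : 0 ≤ p) (hp₁ : p ≤ 1)
    {X Y : Conf n q}
    (h : c + (p * potential adj θ C B X + (1 - p) * potential adj θ C B Y) ≤ r) :
    ENNReal.ofReal c + ∫⁻ u : unitInterval,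
      ENNReal.ofReal (potential adj θ C B (if (u : ℝ) ≤ p then X else Y)) ≤
        ENNReal.ofReal r := by
  have hX := potential_nonneg (adj := adj) h₁ hC hB X
  have hY := potential_nonneg (adj := adj) h₁ hC hB Y
  rw [lintegral_coin (fun X => ENNReal.ofReal (potential adj θ C B X)) X Y hp₀ hp₁,
    ← ENNReal.ofReal_mul hp₀, ← ENNReal.ofReal_mul (sub_nonneg.2 hp₁),
    ← ENNReal.ofReal_add (mul_nonneg hp₀ hX) (mul_nonneg (sub_nonneg.2 hp₁) hY),
    ← ENNReal.ofReal_add hc (add_nonneg (mul_nonneg hp₀ hX) (mul_nonneg (sub_nonneg.2 hp₁) hY))]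
  exact ENNReal.ofReal_le_ofReal h

theorem ofReal_add_potential_le {c r : ℝ} (hc : 0 ≤ c) {X : Conf n q}
    (h : c + potential adj θ C B X ≤ r) :
    ENNReal.ofReal c + ∫⁻ _ : unitInterval, ENNReal.ofReal (potential adj θ C B X) ≤
      ENNReal.ofReal r := by
  have hX := potential_nonneg (adj := adj) h₁ hC hB X
  rw [lintegral_const, measure_univ, mul_one, ← ENNReal.ofReal_add hc hX]
  exact ENNReal.ofReal_le_ofReal h

end Potential

theorem scanPotential_succ {θ C B : ℝ} {v w : Fin n} {i : ℕ} (h : (adj.nbrs v)[i]? = some w) :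
    scanPotential adj θ C B v i =
      nbrPotential θ C B + scanPotential adj θ C B v (i + 1) := by
  obtain ⟨hi, -⟩ := List.getElem?_eq_some_iff.1 h
  have : (adj.nbrs v).length - i = (adj.nbrs v).length - (i + 1) + 1 := by omega
  rw [scanPotential, this, scanPotential]
  push_cast
  ring

/-- The potential decreases in expectation by the cost of a step, if a call with `Δ` neighbours is
worth `B`. -/
theorem lintegral_potential_step [NeZero q] {δ θ C L B : ℝ} (hS : S.Tractable δ)
    (hθ : Soft S θ) (hC : 0 ≤ C) (hL : 0 ≤ L)
    (hB : C + L + (C + S.maxDeg * nbrPotential θ C B) ≤ B) (hB₀ : 0 ≤ B) {Λ : Finset (Fin n)}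
    {X : Conf n q} (hX : Inv adj Λ X) :
    ENNReal.ofReal (stepCost C L X) +
        ∫⁻ u, ENNReal.ofReal (potential adj θ C B (step adj θ X u)) ≤
      ENNReal.ofReal (potential adj θ C B X) := by
  have hα := nbrPotential_nonneg hθ.le_one hC hB₀
  cases X with
  | idle x l T =>
    cases l with
    | nil =>
      simp only [step_idle_nil]
      refine ofReal_add_potential_le hθ.le_one hC hB₀ hC ?_
      simp [potential, queuePotential]
    | cons w l =>
      simp only [step_idle_cons]
      refine ofReal_add_potential_le hθ.le_one hC hB₀ hC ?_
      split_ifs <;> simp [potential, queuePotential, stackPotential] <;> linarith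
  | fresh x l f fs =>
    simp only [step_fresh]
    rw [InverseTransform.lintegral_draw (S.field_nonneg f.vertex) (hS.field_normalized f.vertex)
      fun c => ENNReal.ofReal (potential adj θ C B (.scan (Function.update x f.vertex c) l
        (f.vertex :: f.below) { f with idx := 0 } fs))]
    simp only [potential, stepCost]
    rw [← Finset.sum_mul, ← ENNReal.ofReal_sum_of_nonneg fun c _ => S.field_nonneg _ _,
      hS.field_normalized, ENNReal.ofReal_one, one_mul]
    have hs := scanPotential_nonneg (adj := adj) hθ.le_one hC hB₀ f.vertex 0
    have ht := stackPotential_nonneg (adj := adj) hθ.le_one hC hB₀ fs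
    have hq := queuePotential_nonneg hC hB₀ l
    rw [← ENNReal.ofReal_add (add_nonneg hC hL) (by linarith)]
    refine ENNReal.ofReal_le_ofReal ?_
    have hd : ((adj.nbrs f.vertex).length : ℝ) ≤ S.maxDeg := by
      exact_mod_cast SpinSystem.length_nbrs_le adj f.vertex
    have := mul_le_mul_of_nonneg_right hd hα
    simp only [scanPotential, Nat.sub_zero]
    linarith
  | scan x l T f fs =>
    cases hw : (adj.nbrs f.vertex)[f.idx]? with
    | none =>
      simp only [step_scan_none adj hw]
      refine ofReal_add_potential_le hθ.le_one hC hB₀ hC ?_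
      have hs : C ≤ scanPotential adj θ C B f.vertex f.idx :=
        le_add_of_nonneg_right (mul_nonneg (Nat.cast_nonneg _) hα)
      cases fs <;> simp only [popped, potential, stackPotential] <;> linarith
    | some w =>
      simp only [step_scan_some adj hw]
      have hsucc := scanPotential_succ (θ := θ) (C := C) (B := B) adj hw
      by_cases hb : w ∈ f.below
      · simp only [hb, if_true]
        refine ofReal_add_potential_le hθ.le_one hC hB₀ hC ?_
        have : C ≤ nbrPotential θ C B :=
          le_add_of_nonneg_right (mul_nonneg (sub_nonneg.2 hθ.le_one) (by linarith))
        simp only [potential]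
        linarith
      · simp only [hb, if_false]
        refine ofReal_add_potential_coin_le hθ.le_one hC hB₀ hC hθ.pos.le hθ.le_one ?_
        -- One `B` pays for resolving the neighbour, and the other is reserved for restarting the
        -- caller if the second coin rejects. With the check itself this is the `C + 2 * B` in
        -- `nbrPotential`.
        have hY : potential adj θ C B (if w ∈ T then .check x l T f fs
            else .fresh x l ⟨w, T, 0⟩ (f :: fs)) ≤ B + (C + B +
              scanPotential adj θ C B f.vertex (f.idx + 1) + stackPotential adj θ C B fs) +
              queuePotential C B l := by
          split_ifs <;> simp only [potential, stackPotential] <;> linarith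
        have := mul_le_mul_of_nonneg_left hY (sub_nonneg.2 hθ.le_one)
        simp only [potential, hsucc, nbrPotential] at this ⊢
        linarith
  | check x l T f fs =>
    obtain ⟨hs, hT, w, hwT, hw⟩ := hX
    have hr := hθ.recheck_mem (adj_of_getElem? hw) (x f.vertex) (x w)
    simp only [step_check_some adj hw]
    refine ofReal_add_potential_coin_le hθ.le_one hC hB₀ hC hr.1 hr.2 ?_
    have hsn := scanPotential_nonneg (adj := adj) hθ.le_one hC hB₀ f.vertex (f.idx + 1)
    -- The reserve holds both a restart and the rest of the scan, but the second coin uses only one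
    -- of them; the other is dropped.
    have h₁ := mul_nonneg hr.1 hB₀
    have h₂ := mul_nonneg (sub_nonneg.2 hr.2) hsn
    simp only [potential, stackPotential]
    linarith
  | done x T => simp [step, stepCost, potential]

end LazySampler

/-! ### Straight-line execution -/

namespace RAM

/-- Programs without loops. -/
def Cmd.LoopFree : Cmd → Prop
  | .seq c d => c.LoopFree ∧ d.LoopFree
  | .ite _ c d => c.LoopFree ∧ d.LoopFree
  | .while _ _ => False
  | _ => True

open Classical in
/-- The final state of a program without loops. -/
noncomputable def Cmd.run (I : ProbeInput) (ω : RandomTape) : Cmd → State → State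
  | .skip, s => s
  | .setInt x e, s => { s with int := Function.update s.int x (e.eval I s) }
  | .setReal x e, s => { s with real := Function.update s.real x (e.eval I ω s) }
  | .setArr a i e, s =>
      { s with arr := Function.update s.arr a (Function.update (s.arr a) (i.eval I s) (e.eval I s)) }
  | .sample x v a, s =>
      { s with int := Function.update s.int x (I.spinOf (v.eval I s) (ω (a.eval I s))) }
  | .seq c d, s => d.run I ω (c.run I ω s)
  | .ite b c d, s => if b.Holds I ω s then c.run I ω s else d.run I ω s
  | .while _ _, s => s

/-- A bound on the running time of a program without loops, if drawing a spin costs `L`. -/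
def Cmd.maxCost (L : ℕ) : Cmd → ℕ
  | .skip => 1
  | .setInt _ e => e.cost + 1
  | .setReal _ e => e.cost + 1
  | .setArr _ i e => i.cost + e.cost + 1
  | .sample _ v a => v.cost + a.cost + L + 1
  | .seq c d => c.maxCost L + d.maxCost L
  | .ite b c d => b.cost + (c.maxCost L + d.maxCost L)
  | .while _ _ => 0

theorem Cmd.exec_run (I : ProbeInput) (ω : RandomTape) (c : Cmd) (hc : c.LoopFree) (s : State) :
    ∃ k ≤ c.maxCost (Nat.clog 2 I.q), Exec I ω c s k (c.run I ω s) := by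
  induction c generalizing s with
  | skip => exact ⟨_, le_rfl, .skip s⟩
  | setInt x e => exact ⟨_, le_rfl, .setInt s x e⟩
  | setReal x e => exact ⟨_, le_rfl, .setReal s x e⟩
  | setArr a i e => exact ⟨_, le_rfl, .setArr s a i e⟩
  | sample x v a => exact ⟨_, le_rfl, .sample s x v a⟩
  | seq c d ihc ihd =>
    obtain ⟨k, hk, h₁⟩ := ihc hc.1 s
    obtain ⟨l, hl, h₂⟩ := ihd hc.2 (c.run I ω s)
    exact ⟨_, add_le_add hk hl, .seq h₁ h₂⟩
  | ite b c d ihc ihd =>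
    by_cases hb : b.Holds I ω s
    · obtain ⟨k, hk, h⟩ := ihc hc.1 s
      refine ⟨b.cost + k, by simp only [maxCost]; omega, ?_⟩
      rw [run, if_pos hb]
      exact .iteTrue hb h
    · obtain ⟨k, hk, h⟩ := ihd hc.2 s
      refine ⟨b.cost + k, by simp only [maxCost]; omega, ?_⟩
      rw [run, if_neg hb]
      exact .iteFalse hb h
  | _ => exact hc.elim

end RAM

/-! ### Probes -/

namespace ProbeInput

variable {n q : ℕ} {S : SpinSystem n q} {adj : AdjacencyList S.graph}

theorem toFin?_natCast (v : Fin n) : Int.toFin? n ((v : ℕ) : ℤ) = some v := by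
  simp [Int.toFin?]

theorem probeNbr_natCast (v : Fin n) (i : ℕ) :
    (ProbeInput.mk n q S adj).probeNbr ((v : ℕ) : ℤ) (i : ℤ) =
      (adj.nbrs v)[i]?.elim (-1) fun u => ((u : ℕ) : ℤ) := by
  simp only [probeNbr, toFin?_natCast, Int.natCast_nonneg, if_true, Int.toNat_natCast]
  cases (adj.nbrs v)[i]? <;> rfl

theorem probeInter_natCast {u v : Fin n} (h : S.graph.Adj u v) (a b : Fin q) :
    (ProbeInput.mk n q S adj).probeInter ((u : ℕ) : ℤ) ((v : ℕ) : ℤ) ((a : ℕ) : ℤ) ((b : ℕ) : ℤ) =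
      S.inter u v a b := by
  simp [probeInter, toFin?_natCast, h]

theorem spinOf_natCast [NeZero q] (v : Fin n) (h₁ : ∑ c, S.field v c = 1) {u : unitInterval}
    (hu : (u : ℝ) < 1) :
    (ProbeInput.mk n q S adj).spinOf ((v : ℕ) : ℤ) (u : ℝ) =
      ((InverseTransform.draw (S.field v) u : ℕ) : ℤ) := by
  rw [InverseTransform.draw_val h₁ hu]
  simp [spinOf, toFin?_natCast, InverseTransform.count]

end ProbeInput

/-! ### The program -/

namespace LazySampler

namespace Program

open RAM

/-- The top of the stack of calls. -/
def topIndex : IExpr := .sub (.reg 6) (.const 1)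

/-- Tests whether the vertex in register `9` is among the first `e` vertices of the trail. -/
def memTest (e : IExpr) : Test :=
  -- Membership means that the recorded position is below `e` and that the trail cell there points
  -- back to the vertex. Both conditions are packed into one comparison: a nonzero `d` adds at least
  -- `e + 1` and makes it fail.
  let d : IExpr := .sub (.arr 4 (.arr 3 (.reg 9))) (.reg 9)
  .ile (.add (.mul (.mul d d) (.add e (.const 1))) (.add (.arr 3 (.reg 9)) (.const 1))) e

/-- Calls the sampler on the vertex in register `9`. -/
def push : Cmd :=
  .seq (.setArr 5 (.reg 6) (.reg 9)) <|
  .seq (.setArr 3 (.reg 9) (.reg 7)) <|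
  .seq (.setArr 4 (.reg 7) (.reg 9)) <|
  .seq (.setInt 6 (.add (.reg 6) (.const 1))) <|
  .seq (.setInt 7 (.add (.reg 7) (.const 1))) (.setInt 4 (.const 1))

/-- Moves the top call to its next neighbour. -/
def advance : Cmd := .setArr 2 topIndex (.add (.arr 2 topIndex) (.const 1))

/-- Loads the vertex of the top call. -/
def loadTop : Cmd := .setInt 8 (.arr 5 topIndex)

/-- Loads the current neighbour of the top call. -/
def loadNbr : Cmd := .setInt 9 (.nbr (.reg 8) (.arr 2 topIndex))

/-- Starts the next query. -/
def idle : Cmd :=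
  .ite (.ile (.add (.reg 5) (.const 1)) (.reg 3))
    (.seq (.setInt 9 (.arr 0 (.reg 5))) <|
     .seq (.setInt 5 (.add (.reg 5) (.const 1))) (.ite (memTest (.reg 7)) .skip push))
    (.setInt 4 (.const 4))

/-- Draws a spin for the top call and forgets what the call has resolved so far. -/
def fresh : Cmd :=
  .seq loadTop <|
  .seq (.setInt 7 (.add (.arr 3 (.reg 8)) (.const 1))) <|
  .seq (.sample 11 (.reg 8) (.reg 10)) <|
  .seq (.setArr 1 (.reg 8) (.reg 11)) <|
  .seq (.setArr 2 topIndex (.const 0)) (.setInt 4 (.const 2))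

/-- Returns from the top call. -/
def pop : Cmd :=
  .seq (.setInt 6 (.sub (.reg 6) (.const 1))) <|
  .ite (.ile (.reg 6) (.const 0)) (.setInt 4 (.const 0)) (.setInt 4 (.const 3))

/-- Processes the current neighbour of the top call. -/
def scan : Cmd :=
  .seq loadTop <| .seq loadNbr <|
  .ite (.ile (.reg 9) (.const (-1))) pop <|
  .ite (memTest (.arr 3 (.reg 8))) advance <|
  .ite (.rle (.rand (.reg 10)) (.reg 1)) advance <|
  .ite (memTest (.reg 7)) (.setInt 4 (.const 3)) push

/-- Flips the second coin for the current neighbour of the top call. -/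
def check : Cmd :=
  .seq loadTop <| .seq loadNbr <|
  .ite (.rle (.rand (.reg 10))
      (.div (.sub (.inter (.reg 8) (.reg 9) (.arr 1 (.reg 8)) (.arr 1 (.reg 9))) (.reg 1))
        (.sub (.ofInt (.const 1)) (.reg 1))))
    (.seq advance (.setInt 4 (.const 2))) (.setInt 4 (.const 1))

/-- One step of the sampler. -/
def body : Cmd :=
  .seq
    (.ite (.ile (.reg 4) (.const 0)) idle <|
     .ite (.ile (.reg 4) (.const 1)) fresh <|
     .ite (.ile (.reg 4) (.const 2)) scan check)
    (.setInt 10 (.add (.reg 10) (.const 1)))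

/-- The loop of the sampler. -/
def loop : Cmd := .while (.ile (.reg 4) (.const 3)) body

/-- Computes the threshold `1 - (1 - δ) / (2Δ)`. -/
def setup : Cmd :=
  .setReal 1 (.sub (.ofInt (.const 1)) (.div (.sub (.ofInt (.const 1)) (.reg 0))
    (.mul (.ofInt (.const 2)) (.ofInt (.reg 2)))))

/-- The lazy sampler. -/
def main : Cmd := .seq setup loop

end Program

/-! #### Memory layout -/

section Layout

variable {n : ℕ}

/-- The arrays `trail` and `pos` store the list `T` with its last element at index `0`. -/
def TrailAt (pos trail : ℤ → ℤ) : List (Fin n) → Prop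
  | [] => True
  | v :: T => trail T.length = ((v : ℕ) : ℤ) ∧ pos ((v : ℕ) : ℤ) = T.length ∧ TrailAt pos trail T

/-- The arrays `stack` and `idx` store the stack of calls with the bottom call at index `0`. -/
def StackAt (stack idx : ℤ → ℤ) : List (Frame n) → Prop
  | [] => True
  | f :: fs => stack fs.length = ((f.vertex : ℕ) : ℤ) ∧ idx fs.length = f.idx ∧
      StackAt stack idx fs

variable {pos trail stack idx : ℤ → ℤ} {T T' : List (Fin n)}

/-- This is why a restart costs no cleanup: shortening the recorded length leaves a valid
representation, and stale cells beyond it are ignored. -/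
theorem TrailAt.of_suffix (h : TrailAt pos trail T') (hT : T <:+ T') : TrailAt pos trail T := by
  induction T' with
  | nil =>
    rw [List.suffix_nil.1 hT]
    exact h
  | cons v T' ih =>
    rcases List.suffix_cons_iff.1 hT with rfl | hT
    · exact h
    · exact ih h.2.2 hT

theorem TrailAt.pos_lt (h : TrailAt pos trail T) {v : Fin n} (hv : v ∈ T) :
    pos ((v : ℕ) : ℤ) < T.length ∧ trail (pos ((v : ℕ) : ℤ)) = ((v : ℕ) : ℤ) := by
  induction T with
  | nil => simp at hv
  | cons w T ih =>
    obtain ⟨h₁, h₂, h₃⟩ := h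
    rcases List.mem_cons.1 hv with rfl | hv
    · rw [h₂]
      exact ⟨by simp, h₁⟩
    · obtain ⟨h₄, h₅⟩ := ih h₃ hv
      exact ⟨h₄.trans (by simp), h₅⟩

/-- The position table may hold stale or initial values for unresolved vertices; a live trail cell
that points back is what certifies membership. The lower bound on `i` excludes cells outside the
trail. -/
theorem TrailAt.mem_of_lt (h : TrailAt pos trail T) {v : Fin n} {i : ℤ} (h₀ : 0 ≤ i)
    (hi : i < T.length) (hv : trail i = ((v : ℕ) : ℤ)) : v ∈ T := by
  induction T with
  | nil => simp at hi; omega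
  | cons w T ih =>
    obtain ⟨h₁, h₂, h₃⟩ := h
    by_cases hiT : i = T.length
    · subst hiT
      rw [h₁] at hv
      have : w = v := Fin.ext (by exact_mod_cast hv)
      simp [this]
    · rw [List.length_cons] at hi
      push_cast at hi
      exact List.mem_cons_of_mem _ (ih h₃ (by omega))

/-- The arithmetic form of the membership test. -/
theorem TrailAt.test_iff (h : TrailAt pos trail T) {v : Fin n} (h₀ : 0 ≤ pos ((v : ℕ) : ℤ)) :
    (trail (pos ((v : ℕ) : ℤ)) - ((v : ℕ) : ℤ)) * (trail (pos ((v : ℕ) : ℤ)) - ((v : ℕ) : ℤ)) *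
      ((T.length : ℤ) + 1) + (pos ((v : ℕ) : ℤ) + 1) ≤ T.length ↔ v ∈ T := by
  constructor
  · intro hle
    set d := trail (pos ((v : ℕ) : ℤ)) - ((v : ℕ) : ℤ) with hd
    have hd0 : d = 0 := by
      by_contra hne
      have : 0 < d * d := mul_self_pos.2 hne
      nlinarith
    rw [hd0] at hle
    exact h.mem_of_lt h₀ (by linarith) (by linarith)
  · intro hv
    obtain ⟨h₁, h₂⟩ := h.pos_lt hv
    rw [h₂]
    simp only [sub_self, zero_mul, zero_add]
    omega

theorem TrailAt.congr {pos' trail' : ℤ → ℤ} (h : TrailAt pos trail T)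
    (hpos : ∀ v ∈ T, pos' ((v : ℕ) : ℤ) = pos ((v : ℕ) : ℤ))
    (htrail : ∀ i < (T.length : ℤ), trail' i = trail i) : TrailAt pos' trail' T := by
  induction T with
  | nil => trivial
  | cons v T ih =>
    obtain ⟨h₁, h₂, h₃⟩ := h
    refine ⟨by rw [htrail _ (by simp), h₁], by rw [hpos v List.mem_cons_self, h₂], ih h₃ ?_ ?_⟩
    · exact fun w hw => hpos w (List.mem_cons_of_mem _ hw)
    · intro i hi
      refine htrail i ?_
      rw [List.length_cons]
      push_cast
      omega

theorem TrailAt.push (h : TrailAt pos trail T) {v : Fin n} (hv : v ∉ T) :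
    TrailAt (Function.update pos ((v : ℕ) : ℤ) T.length)
      (Function.update trail (T.length : ℤ) ((v : ℕ) : ℤ)) (v :: T) := by
  refine ⟨by simp, by simp, h.congr ?_ ?_⟩
  · intro w hw
    refine Function.update_of_ne ?_ _ _
    intro he
    have : w = v := Fin.ext (by exact_mod_cast he)
    exact hv (this ▸ hw)
  · exact fun i hi => Function.update_of_ne hi.ne _ _

theorem StackAt.congr {stack' idx' : ℤ → ℤ} {fs : List (Frame n)} (h : StackAt stack idx fs)
    (hstack : ∀ i < (fs.length : ℤ), stack' i = stack i)
    (hidx : ∀ i < (fs.length : ℤ), idx' i = idx i) : StackAt stack' idx' fs := by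
  induction fs with
  | nil => trivial
  | cons f fs ih =>
    obtain ⟨h₁, h₂, h₃⟩ := h
    refine ⟨by rw [hstack _ (by simp), h₁], by rw [hidx _ (by simp), h₂], ih h₃ ?_ ?_⟩
    · exact fun i hi => hstack i (hi.trans (by simp))
    · exact fun i hi => hidx i (hi.trans (by simp))

theorem StackAt.update_stack {fs : List (Frame n)} (h : StackAt stack idx fs) (a : ℤ) :
    StackAt (Function.update stack (fs.length : ℤ) a) idx fs :=
  h.congr (fun _ hi => Function.update_of_ne hi.ne _ _) fun _ _ => rfl

theorem StackAt.update_idx {fs : List (Frame n)} (h : StackAt stack idx fs) (a : ℤ) :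
    StackAt stack (Function.update idx (fs.length : ℤ) a) fs :=
  h.congr (fun _ _ => rfl) fun _ hi => Function.update_of_ne hi.ne _ _

end Layout

/-! #### Simulation -/

section Simulation

open RAM

variable {n q : ℕ} {S : SpinSystem n q}

/-- The part of the memory layout that does not depend on the mode: the queries, the time `t`, the
threshold and the spins. -/
structure Base (query : List (Fin n)) (θ : ℝ) (x : Fin n → Fin q) (l : List (Fin n)) (t : ℕ)
    (s : State) : Prop where
  length : s.int 3 = query.length
  time : s.int 10 = t
  threshold : s.real 1 = θ
  val : ∀ v : Fin n, s.arr 1 ((v : ℕ) : ℤ) = ((x v : ℕ) : ℤ)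
  queries : ∀ i : ℕ, ∀ v : Fin n, query[i]? = some v → s.arr 0 (i : ℤ) = ((v : ℕ) : ℤ)
  pos_nonneg : ∀ v : Fin n, 0 ≤ s.arr 3 ((v : ℕ) : ℤ)
  queue : ∃ pre, query = pre ++ l ∧ s.int 5 = pre.length

/-- The machine state `s` represents a state of the sampler at time `t`. -/
def Sim (query : List (Fin n)) (θ : ℝ) (t : ℕ) (s : State) : Conf n q → Prop
  | .idle x l T => Base query θ x l t s ∧ s.int 4 = 0 ∧ s.int 6 = 0 ∧ s.int 7 = T.length ∧
      TrailAt (s.arr 3) (s.arr 4) T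
  -- Register `7`, the trail length, is left unconstrained here, and so is the scan index of the top
  -- call: a restart inherits stale values of both, and the `fresh` branch recomputes the length
  -- from the position of the top vertex and resets the index.
  | .fresh x l f fs => Base query θ x l t s ∧ s.int 4 = 1 ∧ s.int 6 = fs.length + 1 ∧
      s.arr 5 fs.length = ((f.vertex : ℕ) : ℤ) ∧ StackAt (s.arr 5) (s.arr 2) fs ∧
      TrailAt (s.arr 3) (s.arr 4) (f.vertex :: f.below)
  | .scan x l T f fs => Base query θ x l t s ∧ s.int 4 = 2 ∧ s.int 6 = fs.length + 1 ∧
      s.int 7 = T.length ∧ StackAt (s.arr 5) (s.arr 2) (f :: fs) ∧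
      TrailAt (s.arr 3) (s.arr 4) T
  | .check x l T f fs => Base query θ x l t s ∧ s.int 4 = 3 ∧ s.int 6 = fs.length + 1 ∧
      s.int 7 = T.length ∧ StackAt (s.arr 5) (s.arr 2) (f :: fs) ∧
      TrailAt (s.arr 3) (s.arr 4) T
  | .done x _ => s.int 4 = 4 ∧ ∀ v : Fin n, s.arr 1 ((v : ℕ) : ℤ) = ((x v : ℕ) : ℤ)

end Simulation

end LazySampler

/-! ### Each pass through the loop body simulates one step of the sampler -/

namespace LazySampler

section Simulation

open RAM

variable {n q : ℕ} {S : SpinSystem n q} {adj : AdjacencyList S.graph} {query : List (Fin n)}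
  {θ : ℝ} {t : ℕ} {s : State}

theorem Base.congr {x : Fin n → Fin q} {l : List (Fin n)} {s' : State}
    (h : Base query θ x l t s) (h3 : s'.int 3 = s.int 3) (h5 : s'.int 5 = s.int 5)
    (h10 : s'.int 10 = s.int 10) (hr : s'.real 1 = s.real 1) (h0 : s'.arr 0 = s.arr 0)
    (h1 : s'.arr 1 = s.arr 1) (hp : ∀ v : Fin n, 0 ≤ s'.arr 3 ((v : ℕ) : ℤ)) :
    Base query θ x l t s' where
  length := h3.trans h.length
  time := h10.trans h.time
  threshold := hr.trans h.threshold
  val := h1 ▸ h.val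
  queries := h0 ▸ h.queries
  pos_nonneg := hp
  queue := h5 ▸ h.queue

theorem sim_tick {X : Conf n q} (I : ProbeInput) (ω : RandomTape) (h : Sim query θ t s X) :
    Sim query θ (t + 1) (Cmd.run I ω (.setInt 10 (.add (.reg 10) (.const 1))) s) X := by
  have hb : ∀ {x l}, Base (q := q) query θ x l t s → Base query θ x l (t + 1)
      (Cmd.run I ω (.setInt 10 (.add (.reg 10) (.const 1))) s) := by
    intro x l hb
    exact ⟨by simpa [Cmd.run] using hb.length, by simp [Cmd.run, IExpr.eval, hb.time],
      hb.threshold, hb.val, hb.queries, hb.pos_nonneg, by simpa [Cmd.run] using hb.queue⟩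
  cases X with
  | idle | fresh | scan | check =>
    refine ⟨hb h.1, ?_⟩
    simpa [Cmd.run] using h.2
  | done => simpa [Sim, Cmd.run] using h

theorem run_ite_pos {I : ProbeInput} {ω : RandomTape} {b : Test} {c d : Cmd}
    (h : b.Holds I ω s) : (Cmd.ite b c d).run I ω s = c.run I ω s := if_pos h

theorem run_ite_neg {I : ProbeInput} {ω : RandomTape} {b : Test} {c d : Cmd}
    (h : ¬ b.Holds I ω s) : (Cmd.ite b c d).run I ω s = d.run I ω s := if_neg h

/-- The effect of a call. -/
theorem sim_push (I : ProbeInput) (ω : RandomTape) {x : Fin n → Fin q} {l T : List (Fin n)}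
    {fs : List (Frame n)} {w : Fin n} (hb : Base query θ x l t s) (h9 : s.int 9 = ((w : ℕ) : ℤ))
    (h6 : s.int 6 = fs.length) (h7 : s.int 7 = T.length)
    (hs : StackAt (s.arr 5) (s.arr 2) fs) (hT : TrailAt (s.arr 3) (s.arr 4) T) (hw : w ∉ T) :
    Sim query θ t (Program.push.run I ω s) (.fresh x l ⟨w, T, 0⟩ fs) := by
  simp only [Program.push, Cmd.run, IExpr.eval]
  refine ⟨hb.congr ?_ ?_ ?_ ?_ ?_ ?_ ?_, ?_, ?_, ?_, ?_, ?_⟩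
  case refine_7 =>
    intro v
    simp only [Function.update_self, ne_eq, Nat.reduceEqDiff,
      not_false_eq_true, Function.update_of_ne, h7, Function.update_apply]
    split_ifs
    · positivity
    · exact hb.pos_nonneg v
  all_goals simp [h6, h7, h9]
  · exact hs.update_stack _
  · exact hT.push hw

theorem memTest_reg_iff (I : ProbeInput) (ω : RandomTape) {T : List (Fin n)} {w : Fin n}
    (h9 : s.int 9 = ((w : ℕ) : ℤ)) (h0 : 0 ≤ s.arr 3 ((w : ℕ) : ℤ)) {e : IExpr}
    (he : e.eval I s = T.length) (hT : TrailAt (s.arr 3) (s.arr 4) T) :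
    (Program.memTest e).Holds I ω s ↔ w ∈ T := by
  simp only [Program.memTest, Test.Holds, IExpr.eval, he, h9]
  exact hT.test_iff h0

theorem sim_idle_nil (I : ProbeInput) (ω : RandomTape) {x : Fin n → Fin q} {T : List (Fin n)}
    (h : Sim query θ t s (.idle x [] T)) : Sim query θ t (Program.idle.run I ω s) (.done x T) := by
  obtain ⟨hb, h4, h6, h7, hT⟩ := h
  obtain ⟨pre, hpre, h5⟩ := hb.queue
  have h3 := hb.length
  rw [hpre, List.append_nil] at h3
  simp only [Program.idle, Cmd.run, Test.Holds, IExpr.eval, h3, h5]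
  rw [if_neg (by omega)]
  exact ⟨by simp, hb.val⟩

theorem sim_idle_cons (I : ProbeInput) (ω : RandomTape) {x : Fin n → Fin q} {w : Fin n}
    {l T : List (Fin n)} (h : Sim query θ t s (.idle x (w :: l) T)) :
    Sim query θ t (Program.idle.run I ω s)
      (if w ∈ T then .idle x l T else .fresh x l ⟨w, T, 0⟩ []) := by
  obtain ⟨hb, h4, h6, h7, hT⟩ := h
  obtain ⟨pre, hpre, h5⟩ := hb.queue
  have h3 := hb.length
  rw [hpre] at h3
  have hq : s.arr 0 (pre.length : ℤ) = ((w : ℕ) : ℤ) := hb.queries _ _ (by simp [hpre])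
  have htest : s.int 5 + 1 ≤ s.int 3 := by
    rw [h3, h5, List.length_append, List.length_cons]; push_cast; omega
  set s₁ : State := { s with
    int := Function.update (Function.update s.int 9 ((w : ℕ) : ℤ)) 5 (pre.length + 1) } with hs₁
  have hrun : Program.idle.run I ω s =
      (Cmd.ite (Program.memTest (.reg 7)) .skip Program.push).run I ω s₁ := by
    have hst : (Cmd.setInt 5 (.add (.reg 5) (.const 1))).run I ω
        ((Cmd.setInt 9 (.arr 0 (.reg 5))).run I ω s) = s₁ := by
      simp [Cmd.run, IExpr.eval, h5, hq, hs₁]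
    rw [Program.idle, run_ite_pos (by simpa only [Test.Holds, IExpr.eval] using htest), ← hst]
    rfl
  have hb₁ : Base query θ x l t s₁ :=
    ⟨by simpa [s₁] using hb.length, by simpa [s₁] using hb.time, hb.threshold, hb.val,
      hb.queries, hb.pos_nonneg, pre ++ [w], by simp [hpre], by simp [s₁]⟩
  have h6₁ : s₁.int 6 = 0 := by simpa [s₁] using h6
  have h7₁ : s₁.int 7 = T.length := by simpa [s₁] using h7
  have h9₁ : s₁.int 9 = ((w : ℕ) : ℤ) := by simp [s₁]
  have hmem : (Program.memTest (.reg 7)).Holds I ω s₁ ↔ w ∈ T :=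
    memTest_reg_iff I ω h9₁ (hb.pos_nonneg w) h7₁ hT
  rw [hrun]
  split_ifs with hw
  · rw [run_ite_pos (hmem.2 hw)]
    exact ⟨hb₁, by simpa [s₁, Cmd.run] using h4, h6₁, h7₁, hT⟩
  · rw [run_ite_neg fun h => hw (hmem.1 h)]
    exact sim_push I ω hb₁ h9₁ (by simpa using h6₁) h7₁ trivial hT hw

theorem sim_fresh [NeZero q] (ω : RandomTape) {x : Fin n → Fin q} {l : List (Fin n)} {f : Frame n}
    {fs : List (Frame n)} (h₁ : ∑ c, S.field f.vertex c = 1) (hu : (ω (t : ℤ) : ℝ) < 1)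
    (h : Sim query θ t s (.fresh x l f fs)) :
    Sim query θ t (Program.fresh.run ⟨n, q, S, adj⟩ ω s)
      (.scan (Function.update x f.vertex (InverseTransform.draw (S.field f.vertex) (ω (t : ℤ)))) l
        (f.vertex :: f.below) { f with idx := 0 } fs) := by
  obtain ⟨hb, h4, h6, hv, hs, hT⟩ := h
  set c := InverseTransform.draw (S.field f.vertex) (ω (t : ℤ)) with hc
  -- The machine's inverse transform and `draw` agree only below `1`, where the count of spins is
  -- less than `q`.
  have hc' := ProbeInput.spinOf_natCast (adj := adj) f.vertex h₁ hu
  have hrun : Program.fresh.run ⟨n, q, S, adj⟩ ω s =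
      { s with
        int := Function.update (Function.update (Function.update (Function.update s.int 8
          ((f.vertex : ℕ) : ℤ)) 7 (f.below.length + 1)) 11 ((c : ℕ) : ℤ)) 4 2
        arr := Function.update (Function.update s.arr 1 (Function.update (s.arr 1)
          ((f.vertex : ℕ) : ℤ) ((c : ℕ) : ℤ))) 2 (Function.update (s.arr 2) fs.length 0) } := by
    simp [Program.fresh, Program.loadTop, Program.topIndex, Cmd.run, IExpr.eval, h6, hv, hT.2.1,
      hb.time, hc', hc]
  rw [hrun]
  refine ⟨⟨by simpa using hb.length, by simpa using hb.time, hb.threshold, ?_,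
    by simpa using hb.queries, by simpa using hb.pos_nonneg, by simpa using hb.queue⟩,
    by simp, by simpa using h6, by simp, ?_, by simpa using hT⟩
  · intro v
    by_cases hvf : v = f.vertex
    · subst hvf; simp
    · have : ((v : ℕ) : ℤ) ≠ ((f.vertex : ℕ) : ℤ) := fun he =>
        hvf (Fin.ext (by exact_mod_cast he))
      simp [hvf, this, hb.val v]
  · refine ⟨by simpa using hv, by simp, ?_⟩
    simpa using hs.update_idx 0

/-- The effect of moving to the next neighbour. -/
theorem run_advance (I : ProbeInput) (ω : RandomTape) {k : ℕ} {i : ℕ} (h6 : s.int 6 = k + 1)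
    (h2 : s.arr 2 k = i) : Program.advance.run I ω s =
      { s with arr := Function.update s.arr 2 (Function.update (s.arr 2) k ((i + 1 : ℕ) : ℤ)) } := by
  simp [Program.advance, Program.topIndex, Cmd.run, IExpr.eval, h6, h2]

theorem run_load (ω : RandomTape) (c : Cmd) {f : Frame n} {fs : List (Frame n)}
    (h6 : s.int 6 = fs.length + 1) (hs : StackAt (s.arr 5) (s.arr 2) (f :: fs)) :
    (Cmd.seq Program.loadTop (.seq Program.loadNbr c)).run ⟨n, q, S, adj⟩ ω s =
      c.run ⟨n, q, S, adj⟩ ω { s with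
        int := Function.update (Function.update s.int 8 ((f.vertex : ℕ) : ℤ)) 9
          ((adj.nbrs f.vertex)[f.idx]?.elim (-1) fun w => ((w : ℕ) : ℤ)) } := by
  rw [← ProbeInput.probeNbr_natCast]
  simp [Program.loadTop, Program.loadNbr, Program.topIndex, Cmd.run, IExpr.eval, h6, hs.1, hs.2.1]

theorem sim_scan (ω : RandomTape) {x : Fin n → Fin q} {l T : List (Fin n)} {f : Frame n}
    {fs : List (Frame n)} (hfT : (f.vertex :: f.below) <:+ T)
    (h : Sim query θ t s (.scan x l T f fs)) :
    Sim query θ t (Program.scan.run ⟨n, q, S, adj⟩ ω s)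
      (match (adj.nbrs f.vertex)[f.idx]? with
      | none => popped x l T fs
      | some w =>
          if w ∈ f.below then .scan x l T { f with idx := f.idx + 1 } fs
          else if (ω (t : ℤ) : ℝ) ≤ θ then .scan x l T { f with idx := f.idx + 1 } fs
          else if w ∈ T then .check x l T f fs
          else .fresh x l ⟨w, T, 0⟩ (f :: fs)) := by
  obtain ⟨hb, h4, h6, h7, hs, hT⟩ := h
  rw [Program.scan, run_load ω _ h6 hs]
  cases hw : (adj.nbrs f.vertex)[f.idx]? with
  | none =>
    rw [Option.elim_none]
    rw [run_ite_pos (by simp [Test.Holds, IExpr.eval])]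
    cases fs with
    | nil =>
      rw [Program.pop, Cmd.run, run_ite_pos (by simp [Test.Holds, IExpr.eval, Cmd.run, h6])]
      exact ⟨hb.congr (by simp [Cmd.run]) (by simp [Cmd.run]) (by simp [Cmd.run]) rfl rfl rfl
        hb.pos_nonneg, by simp [Cmd.run, IExpr.eval], by simp [Cmd.run, IExpr.eval, h6],
        by simpa [Cmd.run] using h7, hT⟩
    | cons f' fs =>
      rw [Program.pop, Cmd.run, run_ite_neg (by
        simp [Test.Holds, IExpr.eval, Cmd.run, h6])]
      exact ⟨hb.congr (by simp [Cmd.run]) (by simp [Cmd.run]) (by simp [Cmd.run]) rfl rfl rfl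
        hb.pos_nonneg, by simp [Cmd.run, IExpr.eval], by simp [Cmd.run, IExpr.eval, h6],
        by simpa [Cmd.run] using h7, hs.2.2, hT⟩
  | some w =>
    rw [Option.elim_some]
    rw [run_ite_neg (by simp [Test.Holds, IExpr.eval]; omega)]
    set s₁ : State := { s with
      int := Function.update (Function.update s.int 8 ((f.vertex : ℕ) : ℤ)) 9 ((w : ℕ) : ℤ) }
    have h6₁ : s₁.int 6 = fs.length + 1 := by simpa [s₁] using h6
    have h7₁ : s₁.int 7 = T.length := by simpa [s₁] using h7
    have h8₁ : s₁.int 8 = ((f.vertex : ℕ) : ℤ) := by simp [s₁]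
    have h9₁ : s₁.int 9 = ((w : ℕ) : ℤ) := by simp [s₁]
    have hb₁ : Base query θ x l t s₁ :=
      hb.congr (by simp [s₁]) (by simp [s₁]) (by simp [s₁]) rfl rfl rfl hb.pos_nonneg
    have hf := hT.of_suffix hfT
    -- The calling vertex sits on the trail directly above `f.below`, so its own position equals the
    -- length of that list. One trail thus serves the membership tests for all stack levels.
    have hbelow := memTest_reg_iff ⟨n, q, S, adj⟩ ω (e := .arr 3 (.reg 8)) h9₁ (hb.pos_nonneg w)
      (by simpa only [IExpr.eval, h8₁] using hf.2.1) hf.2.2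
    have htrail := memTest_reg_iff ⟨n, q, S, adj⟩ ω (e := .reg 7) h9₁ (hb.pos_nonneg w)
      h7₁ hT
    have hcoin : (Test.rle (.rand (.reg 10)) (.reg 1)).Holds ⟨n, q, S, adj⟩ ω s₁ ↔
        (ω (t : ℤ) : ℝ) ≤ θ := by
      simp only [Test.Holds, RExpr.eval, IExpr.eval, hb₁.time, hb₁.threshold]
    have hadv : Sim query θ t (Program.advance.run ⟨n, q, S, adj⟩ ω s₁)
        (.scan x l T { f with idx := f.idx + 1 } fs) := by
      rw [run_advance _ _ h6₁ hs.2.1]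
      refine ⟨hb₁.congr rfl rfl rfl rfl (by simp) (by simp) (by simpa using hb.pos_nonneg),
        by simpa [s₁] using h4, h6₁, h7₁, ⟨by simpa using hs.1, by simp, ?_⟩, by simpa using hT⟩
      simpa using hs.2.2.update_idx _
    dsimp only
    split_ifs with c₁ c₂ c₃
    · rwa [run_ite_pos (hbelow.2 c₁)]
    · rwa [run_ite_neg (fun h => c₁ (hbelow.1 h)), run_ite_pos (hcoin.2 c₂)]
    · rw [run_ite_neg (fun h => c₁ (hbelow.1 h)), run_ite_neg (fun h => c₂ (hcoin.1 h)),
        run_ite_pos (htrail.2 c₃)]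
      exact ⟨hb₁.congr (by simp [Cmd.run]) (by simp [Cmd.run]) (by simp [Cmd.run]) rfl rfl rfl
        hb.pos_nonneg, by simp [Cmd.run, IExpr.eval], by simpa [Cmd.run] using h6₁,
        by simpa [Cmd.run] using h7₁, hs, hT⟩
    · rw [run_ite_neg (fun h => c₁ (hbelow.1 h)), run_ite_neg (fun h => c₂ (hcoin.1 h)),
        run_ite_neg (fun h => c₃ (htrail.1 h))]
      exact sim_push _ ω hb₁ h9₁ (by simpa using h6₁) h7₁ hs hT c₃

theorem sim_check (ω : RandomTape) {x : Fin n → Fin q} {l T : List (Fin n)} {f : Frame n}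
    {fs : List (Frame n)} (hfT : (f.vertex :: f.below) <:+ T) {w : Fin n}
    (hw : (adj.nbrs f.vertex)[f.idx]? = some w) (h : Sim query θ t s (.check x l T f fs)) :
    Sim query θ t (Program.check.run ⟨n, q, S, adj⟩ ω s)
      (if (ω (t : ℤ) : ℝ) ≤ recheck θ (S.inter f.vertex w (x f.vertex) (x w)) then
        .scan x l T { f with idx := f.idx + 1 } fs
      else .fresh x l f fs) := by
  obtain ⟨hb, h4, h6, h7, hs, hT⟩ := h
  rw [Program.check, run_load ω _ h6 hs, hw, Option.elim_some]
  set s₁ : State := { s with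
    int := Function.update (Function.update s.int 8 ((f.vertex : ℕ) : ℤ)) 9 ((w : ℕ) : ℤ) }
  have h6₁ : s₁.int 6 = fs.length + 1 := by simpa [s₁] using h6
  have h7₁ : s₁.int 7 = T.length := by simpa [s₁] using h7
  have h8₁ : s₁.int 8 = ((f.vertex : ℕ) : ℤ) := by simp [s₁]
  have h9₁ : s₁.int 9 = ((w : ℕ) : ℤ) := by simp [s₁]
  have hb₁ : Base query θ x l t s₁ :=
    hb.congr (by simp [s₁]) (by simp [s₁]) (by simp [s₁]) rfl rfl rfl hb.pos_nonneg
  have hcoin : (Test.rle (.rand (.reg 10))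
      (.div (.sub (.inter (.reg 8) (.reg 9) (.arr 1 (.reg 8)) (.arr 1 (.reg 9))) (.reg 1))
        (.sub (.ofInt (.const 1)) (.reg 1)))).Holds ⟨n, q, S, adj⟩ ω s₁ ↔
      (ω (t : ℤ) : ℝ) ≤ recheck θ (S.inter f.vertex w (x f.vertex) (x w)) := by
    simp only [Test.Holds, RExpr.eval, IExpr.eval, hb₁.time, hb₁.threshold, h8₁, h9₁, hb₁.val,
      ProbeInput.probeInter_natCast (adj_of_getElem? hw), recheck, Int.cast_one]
  split_ifs with c
  · rw [run_ite_pos (hcoin.2 c), Cmd.run, run_advance _ _ h6₁ hs.2.1]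
    refine ⟨hb₁.congr (by simp [Cmd.run]) (by simp [Cmd.run]) (by simp [Cmd.run]) rfl
      (by simp [Cmd.run]) (by simp [Cmd.run]) (by simpa [Cmd.run] using hb.pos_nonneg),
      by simp [Cmd.run, IExpr.eval], by simpa [Cmd.run] using h6₁, by simpa [Cmd.run] using h7₁,
      ⟨by simpa [Cmd.run] using hs.1, by simp [Cmd.run], ?_⟩, by simpa [Cmd.run] using hT⟩
    simpa [Cmd.run] using hs.2.2.update_idx _
  · rw [run_ite_neg fun h => c (hcoin.1 h)]
    exact ⟨hb₁.congr (by simp [Cmd.run]) (by simp [Cmd.run]) (by simp [Cmd.run]) rfl rfl rfl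
      hb.pos_nonneg, by simp [Cmd.run, IExpr.eval], by simpa [Cmd.run] using h6₁,
      hs.1, hs.2.2, hT.of_suffix hfT⟩

/-- Executing a branch of the loop body. -/
theorem exec_body {I : ProbeInput} {ω : RandomTape} {X : Conf n q} {c : Cmd} {K : ℕ}
    (hc : c.LoopFree) (hK : c.maxCost (Nat.clog 2 I.q) ≤ K)
    (hsel : ∀ k s', Exec I ω c s k s' → ∃ l ≤ k + 9, Exec I ω
      (.ite (.ile (.reg 4) (.const 0)) Program.idle <|
        .ite (.ile (.reg 4) (.const 1)) Program.fresh <|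
        .ite (.ile (.reg 4) (.const 2)) Program.scan Program.check) s l s')
    (h : Sim query θ t (c.run I ω s) X) :
    ∃ k s', Exec I ω Program.body s k s' ∧ k ≤ K + 13 ∧ Sim query θ (t + 1) s' X := by
  obtain ⟨k, hk, he⟩ := c.exec_run I ω hc s
  obtain ⟨l, hl, he'⟩ := hsel k _ he
  -- The additive `13` is at most `9` for three mode tests plus `4` for advancing the clock.
  refine ⟨_, _, .seq he' (.setInt _ _ _), ?_, sim_tick I ω h⟩
  simp only [IExpr.cost]
  omega

/-- The clock register equals the time of the chain, so the machine reads the same random cell as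
`step`. The extra `3` in the cost is the loop test. -/
theorem sim_body [NeZero q] {δ : ℝ} (hS : S.Tractable δ) (ω : RandomTape)
    (hu : (ω (t : ℤ) : ℝ) < 1) {Λ : Finset (Fin n)} {X : Conf n q} (hX : Inv adj Λ X)
    (h : Sim query θ t s X) (hD : ∀ x T, X ≠ .done x T) :
    ∃ k s', Exec ⟨n, q, S, adj⟩ ω Program.body s k s' ∧
      ((k + 3 : ℕ) : ℝ) ≤ stepCost 300 (Nat.clog 2 q) X ∧
      Sim query θ (t + 1) s' (step adj θ X (ω (t : ℤ))) := by
  cases X with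
  | idle x l T =>
    have hsim : Sim query θ t (Program.idle.run ⟨n, q, S, adj⟩ ω s)
        (step adj θ (.idle x l T) (ω (t : ℤ))) := by
      cases l with
      | nil => exact sim_idle_nil _ ω h
      | cons w l => exact sim_idle_cons _ ω h
    -- `200` is a generous bound for the branch; with the overheads `13` and `3` it stays below the
    -- `300` charged per step.
    obtain ⟨k, s', he, hk, hs'⟩ := exec_body (K := 200)
      (by simp [Program.idle, Program.push, Cmd.LoopFree])
      (by simp [Program.idle, Program.push, Program.memTest, Cmd.maxCost, Test.cost, IExpr.cost])
      (fun k s' he => ⟨_, by simp only [Test.cost, IExpr.cost]; omega,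
        .iteTrue (by simp [Test.Holds, IExpr.eval, h.2.1]) he⟩) hsim
    exact ⟨k, s', he, by simp only [stepCost]; norm_cast; omega, hs'⟩
  | fresh x l f fs =>
    have hsim := sim_fresh (adj := adj) ω (hS.field_normalized f.vertex) hu h
    obtain ⟨k, s', he, hk, hs'⟩ := exec_body (K := 200 + Nat.clog 2 q)
      (by simp [Program.fresh, Program.loadTop, Cmd.LoopFree])
      (by
        simp only [Program.fresh, Program.loadTop, Program.topIndex, Cmd.maxCost, IExpr.cost]
        omega)
      (fun k s' he => ⟨_, by simp only [Test.cost, IExpr.cost]; omega,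
        .iteFalse (by simp [Test.Holds, IExpr.eval, h.2.1]) <|
        .iteTrue (by simp [Test.Holds, IExpr.eval, h.2.1]) he⟩) hsim
    exact ⟨k, s', he, by simp only [stepCost]; norm_cast; omega, hs'⟩
  | scan x l T f fs =>
    obtain ⟨k, s', he, hk, hs'⟩ := exec_body (K := 200)
      (by simp [Program.scan, Program.push, Program.loadTop, Program.loadNbr, Program.pop,
        Program.advance, Cmd.LoopFree])
      (by simp [Program.scan, Program.push, Program.loadTop, Program.loadNbr, Program.pop,
        Program.advance, Program.topIndex, Program.memTest, Cmd.maxCost, Test.cost, IExpr.cost,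
        RExpr.cost])
      (fun k s' he => ⟨_, by simp only [Test.cost, IExpr.cost]; omega,
        .iteFalse (by simp [Test.Holds, IExpr.eval, h.2.1]) <|
        .iteFalse (by simp [Test.Holds, IExpr.eval, h.2.1]) <|
        .iteTrue (by simp [Test.Holds, IExpr.eval, h.2.1]) he⟩)
      (sim_scan (adj := adj) ω hX.2 h)
    exact ⟨k, s', he, by simp only [stepCost]; norm_cast; omega, hs'⟩
  | check x l T f fs =>
    obtain ⟨-, hT, w, -, hw⟩ := hX
    obtain ⟨k, s', he, hk, hs'⟩ := exec_body (K := 200)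
      (by simp [Program.check, Program.loadTop, Program.loadNbr, Program.advance, Cmd.LoopFree])
      (by simp [Program.check, Program.loadTop, Program.loadNbr, Program.advance,
        Program.topIndex, Cmd.maxCost, Test.cost, IExpr.cost, RExpr.cost])
      (fun k s' he => ⟨_, by simp only [Test.cost, IExpr.cost]; omega,
        .iteFalse (by simp [Test.Holds, IExpr.eval, h.2.1]) <|
        .iteFalse (by simp [Test.Holds, IExpr.eval, h.2.1]) <|
        .iteFalse (by simp [Test.Holds, IExpr.eval, h.2.1]) he⟩)
      (sim_check ω hT hw h)
    rw [step_check_some adj hw]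
    exact ⟨k, s', he, by simp only [stepCost]; norm_cast; omega, hs'⟩
  | done x T => exact absurd rfl (hD x T)

/-- The chain of states of the sampler on a list of queries. -/
noncomputable def trajectory [NeZero q] (adj : AdjacencyList S.graph) (θ : ℝ)
    (query : List (Fin n)) : ℕ → RandomTape → Conf n q :=
  TapeChain.chain (step adj θ) (.idle (fun _ => 0) query [])

theorem inv_trajectory [NeZero q] (t : ℕ) (ω : RandomTape) :
    Inv adj query.toFinset (trajectory adj θ query t ω) :=
  TapeChain.chain_invariant (fun _ hv => .inl (List.mem_toFinset.1 hv))
    (fun X u => inv_step adj θ query.toFinset X u) t ω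

theorem trajectory_add_of_done [NeZero q] {ω : RandomTape} {x : Fin n → Fin q} {T : List (Fin n)}
    (h : trajectory adj θ query t ω = .done x T) (m : ℕ) :
    trajectory adj θ query (t + m) ω = .done x T := by
  induction m with
  | zero => exact h
  | succ m ih =>
    change step adj θ (trajectory adj θ query (t + m) ω) _ = _
    rw [ih]
    rfl

theorem stepCost_nonneg {C L : ℝ} (hC : 0 ≤ C) (hL : 0 ≤ L) (X : Conf n q) :
    0 ≤ stepCost C L X := by
  cases X <;> simp only [stepCost] <;> linarith

theorem exec_loop_of_done [NeZero q] (ω : RandomTape) {x x' : Fin n → Fin q} {T T' : List (Fin n)}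
    (m : ℕ) (h : Sim query θ t s (trajectory adj θ query t ω))
    (hm : trajectory adj θ query (t + m) ω = .done x T)
    (hd : trajectory adj θ query t ω = .done x' T') :
    ∃ k s', Exec ⟨n, q, S, adj⟩ ω Program.loop s k s' ∧
      (k : ℝ) ≤ ∑ i ∈ Finset.range m,
        stepCost 300 (Nat.clog 2 q) (trajectory adj θ query (t + i) ω) + 3 ∧
      ∀ v : Fin n, s'.arr 1 ((v : ℕ) : ℤ) = ((x v : ℕ) : ℤ) := by
  have he := trajectory_add_of_done hd m
  rw [hm] at he
  obtain ⟨rfl, rfl⟩ := Conf.done.inj he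
  rw [hd] at h
  refine ⟨_, s, .whileFalse (by simp [Test.Holds, IExpr.eval, h.1]), ?_, h.2⟩
  have := Finset.sum_nonneg fun i (_ : i ∈ Finset.range m) =>
    stepCost_nonneg (C := 300) (L := Nat.clog 2 q) (by norm_num) (Nat.cast_nonneg _)
      (trajectory adj θ query (t + i) ω)
  simp only [Test.cost, IExpr.cost]
  push_cast
  linarith

/-- Induction on the number of steps known to suffice. The machine may stop earlier than that; this
is harmless because `done` is absorbing and the costs are nonnegative. -/
theorem exec_loop [NeZero q] {δ : ℝ} (hS : S.Tractable δ) (ω : RandomTape)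
    (hu : ∀ i, (ω i : ℝ) < 1) {x : Fin n → Fin q} {T : List (Fin n)} (m : ℕ)
    (h : Sim query θ t s (trajectory adj θ query t ω))
    (hm : trajectory adj θ query (t + m) ω = .done x T) :
    ∃ k s', Exec ⟨n, q, S, adj⟩ ω Program.loop s k s' ∧
      (k : ℝ) ≤ ∑ i ∈ Finset.range m,
        stepCost 300 (Nat.clog 2 q) (trajectory adj θ query (t + i) ω) + 3 ∧
      ∀ v : Fin n, s'.arr 1 ((v : ℕ) : ℤ) = ((x v : ℕ) : ℤ) := by
  induction m generalizing t s with
  | zero => exact exec_loop_of_done ω 0 h hm hm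
  | succ m ih =>
    by_cases hD : ∃ x' T', trajectory adj θ query t ω = .done x' T'
    · obtain ⟨x', T', hd⟩ := hD
      exact exec_loop_of_done ω (m + 1) h hm hd
    · push Not at hD
      obtain ⟨k, s', he, hk, hs'⟩ := sim_body hS ω (hu t) (inv_trajectory t ω) h hD
      obtain ⟨l, s'', hl, hlk, hv⟩ := ih (t := t + 1) hs' (by rw [← hm]; congr 1; omega)
      have hmode : (Test.ile (.reg 4) (.const 3)).Holds ⟨n, q, S, adj⟩ ω s := by
        cases hc : trajectory adj θ query t ω with
        | done x' T' => exact absurd hc (hD x' T')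
        | idle | fresh | scan | check =>
          rw [hc] at h
          simp [Test.Holds, IExpr.eval, h.2.1]
      refine ⟨_, s'', .whileTrue hmode he hl, ?_, hv⟩
      rw [Finset.sum_range_succ', add_zero]
      simp only [Test.cost, IExpr.cost]
      simp only [show ∀ i, t + 1 + i = t + (i + 1) by intro i; omega] at hlk
      push_cast at hk ⊢
      linarith

end Simulation

end LazySampler

/-! ### The main theorem -/

/-- Removes the null event on which inverse-transform sampling can return a number that is not a
spin. -/
theorem ae_tape_lt_one : ∀ᵐ ω ∂tapeMeasure, ∀ i, (ω i : ℝ) < 1 := by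
  rw [ae_all_iff]
  intro i
  have h : ∀ᵐ u : unitInterval, (u : ℝ) < 1 := by
    have h₁ : ∀ᵐ u : unitInterval, u ≠ 1 := by
      rw [ae_iff]
      simp
    filter_upwards [h₁] with u hu
    exact lt_of_le_of_ne u.2.2 fun h => hu (Subtype.ext h)
  have hp : MeasurePreserving (Function.eval i) tapeMeasure (volume : Measure unitInterval) :=
    measurePreserving_eval_infinitePi _ i
  exact hp.quasiMeasurePreserving.ae h

/-! ### The threshold and the target marginals -/

namespace SpinSystem

variable {n q : ℕ} {S : SpinSystem n q} {δ : ℝ}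

/-- No upper bound on `δ` is assumed. A positive maximum degree supplies an edge, whose entries are
at least the threshold and at most one. -/
theorem Tractable.threshold_le_one [NeZero q] (hS : S.Tractable δ) :
    1 - (1 - δ) / (2 * (S.maxDeg : ℝ)) ≤ 1 := by
  classical
  have hadj : ∃ u v, S.graph.Adj u v := by
    by_contra! h
    have hd : S.maxDeg ≤ 0 := by
      unfold maxDeg
      refine SimpleGraph.maxDegree_le_of_forall_degree_le _ _ fun v => ?_
      rw [← SimpleGraph.card_neighborFinset_eq_degree, Nat.le_zero, Finset.card_eq_zero,
        Finset.eq_empty_iff_forall_notMem]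
      intro u hu
      exact h v u ((SimpleGraph.mem_neighborFinset _ _ _).1 hu)
    have := hS.one_le_maxDeg
    omega
  obtain ⟨u, v, huv⟩ := hadj
  exact (hS.soft u v huv 0 0).trans ((hS.inter_normalized u v huv).2 ⟨(0, 0), rfl⟩)

theorem Tractable.isSoft [NeZero q] (hS : S.Tractable δ) (hδ : 0 < δ) :
    LazySampler.Soft S (1 - (1 - δ) / (2 * (S.maxDeg : ℝ))) where
  pos := hS.threshold_pos hδ
  le_one := hS.threshold_le_one
  le_inter := hS.soft
  inter_le u v huv a b := (hS.inter_normalized u v huv).2 ⟨(a, b), rfl⟩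

open Classical in
/-- The indicator of the configurations that extend `τ`. -/
noncomputable def extendsIndicator (Λ : Finset (Fin n)) (τ : Λ → Fin q) (σ : Fin n → Fin q) : ℝ :=
  if ∀ v : Λ, σ v = τ v then 1 else 0

theorem extendsIndicator_nonneg (Λ : Finset (Fin n)) (τ : Λ → Fin q) (σ : Fin n → Fin q) :
    0 ≤ extendsIndicator Λ τ σ := by
  unfold extendsIndicator
  split_ifs <;> norm_num

/-- Identifies the value of the initial state, where the trail is empty, with the target
probability. -/
theorem avg_univ_eq_marginal (Λ : Finset (Fin n)) (τ : Λ → Fin q) (x : Fin n → Fin q) :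
    S.avg Finset.univ (extendsIndicator Λ τ) x = S.marginal Λ τ := by
  unfold avg marginal gibbs
  rw [← Finset.sum_div, Finset.sum_filter]
  congr 1
  · refine Finset.sum_congr rfl fun σ _ => ?_
    rw [S.subWeight_univ, Finset.piecewise_univ, extendsIndicator, mul_ite, mul_one, mul_zero]
  · exact Finset.sum_congr rfl fun σ _ => S.subWeight_univ σ

theorem Tractable.sum_marginal (hS : S.Tractable δ) (hδ : 0 < δ) (Λ : Finset (Fin n)) :
    ∑ τ, S.marginal Λ τ = 1 := by
  classical
  unfold marginal
  simp only [Finset.sum_filter]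
  rw [Finset.sum_comm]
  have hZ := hS.subTotal_pos hδ Finset.univ
  simp only [subTotal, subWeight_univ] at hZ
  trans ∑ σ, S.gibbs σ
  · refine Finset.sum_congr rfl fun σ _ => ?_
    rw [Finset.sum_eq_single fun v : Λ => σ v]
    · simp
    · intro τ _ hτ
      rw [if_neg]
      exact fun h => hτ (funext fun v => (h v).symm)
    · simp
  · simp only [gibbs, ← Finset.sum_div]
    exact div_self hZ.ne'

theorem marginal_nonneg [NeZero q] (Λ : Finset (Fin n)) (τ : Λ → Fin q) : 0 ≤ S.marginal Λ τ := by
  rw [← avg_univ_eq_marginal Λ τ fun _ => 0]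
  exact avg_nonneg (extendsIndicator_nonneg Λ τ) _

end SpinSystem

/-! ### Output law and expected running time -/

namespace LazySampler

open RAM

variable {n q : ℕ} {S : SpinSystem n q} {adj : AdjacencyList S.graph} {δ : ℝ}
  {query : List (Fin n)}

/-- The threshold below which the first coin accepts an edge. -/
noncomputable def threshold (S : SpinSystem n q) (δ : ℝ) : ℝ := 1 - (1 - δ) / (2 * (S.maxDeg : ℝ))

/-- The time bound for a call. -/
noncomputable def callBound (S : SpinSystem n q) (δ : ℝ) : ℝ :=
  (Nat.clog 2 q + 1200 * S.maxDeg) / δ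

/-- The event that the sampler outputs a configuration in `D`. -/
def finishesIn [NeZero q] (adj : AdjacencyList S.graph) (δ : ℝ) (query : List (Fin n))
    (D : Set (Fin n → Fin q)) : Set RandomTape :=
  {ω | ∃ t, trajectory adj (threshold S δ) query t ω ∈ {X | ∃ x ∈ D, ∃ T, X = .done x T}}

theorem sim_setup [NeZero q] (ω : RandomTape) :
    Sim query (threshold S δ) 0
      (Program.setup.run ⟨n, q, S, adj⟩ ω (initState ⟨n, q, S, adj⟩ δ query))
      (.idle (fun _ : Fin n => (0 : Fin q)) query []) := by
  refine ⟨⟨rfl, rfl, ?_, ?_, ?_, fun v => le_rfl, [], rfl, rfl⟩, rfl, rfl, rfl, trivial⟩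
  · simp [Program.setup, Cmd.run, RExpr.eval, IExpr.eval, initState, threshold]
  · intro v
    simp [Program.setup, Cmd.run, initState]
  · intro i v hv
    simp [Program.setup, Cmd.run, initState, hv]

theorem exec_main [NeZero q] (hS : S.Tractable δ) {ω : RandomTape} (hu : ∀ i, (ω i : ℝ) < 1)
    {t : ℕ} {x : Fin n → Fin q} {T : List (Fin n)}
    (ht : trajectory adj (threshold S δ) query t ω = .done x T) :
    ∃ k s, Exec ⟨n, q, S, adj⟩ ω Program.main (initState ⟨n, q, S, adj⟩ δ query) k s ∧
      (k : ℝ) ≤ ∑ i ∈ Finset.range t,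
        stepCost 300 (Nat.clog 2 q) (trajectory adj (threshold S δ) query i ω) + 20 ∧
      ∀ v : Fin n, s.arr 1 ((v : ℕ) : ℤ) = ((x v : ℕ) : ℤ) := by
  obtain ⟨k, s, he, hk, hv⟩ := exec_loop hS ω hu (t := 0) t (sim_setup ω) (by rwa [zero_add])
  -- Setting the threshold costs `14` and leaving the loop costs `3`, which the constant `20`
  -- covers.
  refine ⟨_, s, .seq (.setReal _ _ _) he, ?_, hv⟩
  simp only [zero_add] at hk
  simp only [RExpr.cost, IExpr.cost]
  push_cast
  linarith

/-- The subcriticality of the recursion. Since `Δ(1 - θ) = (1 - δ) / 2`, recursive calls and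
restarts return `(1 - δ)B`. The remaining cost is at most `clog q + 750 + 300Δ`, which `δB = clog q
+ 1200Δ` covers because `Δ ≥ 1`. -/
theorem callBound_ge [NeZero q] (hS : S.Tractable δ) (hδ : 0 < δ) :
    300 + Nat.clog 2 q + (300 + S.maxDeg * nbrPotential (threshold S δ) 300 (callBound S δ)) ≤
      callBound S δ := by
  have hΔ : (1 : ℝ) ≤ S.maxDeg := by exact_mod_cast hS.one_le_maxDeg
  have hB : δ * callBound S δ = Nat.clog 2 q + 1200 * S.maxDeg := mul_div_cancel₀ _ hδ.ne'
  have hθ : S.maxDeg * (1 - threshold S δ) = (1 - δ) / 2 := by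
    rw [threshold]
    field_simp
    ring
  have hexp : S.maxDeg * nbrPotential (threshold S δ) 300 (callBound S δ) =
      300 * S.maxDeg + (1 - δ) / 2 * (300 + 2 * callBound S δ) := by
    rw [nbrPotential, ← hθ]
    ring
  rw [hexp]
  nlinarith

theorem callBound_nonneg (hδ : 0 < δ) : 0 ≤ callBound S δ := by
  unfold callBound
  positivity

theorem ofReal_stepCost_add_lintegral_le [NeZero q] (hS : S.Tractable δ) (hδ : 0 < δ)
    (X : Conf n q) (hX : Inv adj query.toFinset X) :
    ENNReal.ofReal (stepCost 300 (Nat.clog 2 q) X) + ∫⁻ u, ENNReal.ofReal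
      (potential adj (threshold S δ) 300 (callBound S δ) (step adj (threshold S δ) X u)) ≤
      ENNReal.ofReal (potential adj (threshold S δ) 300 (callBound S δ) X) :=
  lintegral_potential_step adj hS (hS.isSoft hδ) (by norm_num) (Nat.cast_nonneg _)
    (callBound_ge hS hδ) (callBound_nonneg hδ) hX

theorem ae_finishes [NeZero q] (hS : S.Tractable δ) (hδ : 0 < δ) :
    ∀ᵐ ω ∂tapeMeasure, ∃ t x T, trajectory adj (threshold S δ) query t ω = .done x T := by
  have h := TapeChain.ae_exists_mem (measurable_step adj (threshold S δ))
    (x₀ := .idle (fun _ => 0) query []) (p := Inv adj query.toFinset)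
    (fun _ hv => .inl (List.mem_toFinset.1 hv))
    (fun X u => inv_step adj _ _ X u) (ofReal_stepCost_add_lintegral_le hS hδ)
    ENNReal.ofReal_ne_top (D := {X | ∃ x T, X = .done x T}) (by
      intro X hX
      rw [ENNReal.one_le_ofReal]
      have hL : (0 : ℝ) ≤ Nat.clog 2 q := Nat.cast_nonneg _
      cases X with
      | done x T => exact absurd ⟨x, T, rfl⟩ hX
      | idle | fresh | scan | check => simp only [stepCost]; linarith)
  exact h

/-- The value with the indicator of `τ` as test function starts at the marginal. It equals one at a
final state that extends `τ`: all queries are on the trail by then, so averaging over the rest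
cannot change the indicator. -/
theorem measure_finishesIn_le [NeZero q] (hS : S.Tractable δ) (hδ : 0 < δ)
    (τ : query.toFinset → Fin q) :
    tapeMeasure (finishesIn adj δ query {x | ∀ v : query.toFinset, x v = τ v}) ≤
      ENNReal.ofReal (S.marginal query.toFinset τ) := by
  have hg := SpinSystem.extendsIndicator_nonneg query.toFinset τ
  refine (TapeChain.measure_exists_mem_le (measurable_step adj (threshold S δ))
    (x₀ := .idle (fun _ => 0) query []) (p := Inv adj query.toFinset)
    (f := fun X => ENNReal.ofReal (value adj (threshold S δ)
      (SpinSystem.extendsIndicator query.toFinset τ) X))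
    (fun _ hv => .inl (List.mem_toFinset.1 hv)) (fun X u => inv_step adj _ _ X u)
    (fun X hX => (lintegral_value_step adj hS hδ (hS.isSoft hδ) hg hX).le) ?_ ?_).trans_eq ?_
  · rintro _ ⟨x, hx, T, rfl⟩ u
    exact ⟨x, hx, T, rfl⟩
  · rintro _ ⟨x, hx, T, rfl⟩ hX
    rw [ENNReal.one_le_ofReal]
    refine (hS.avg_const hδ fun σ hσ => ?_).ge
    rw [SpinSystem.extendsIndicator, if_pos]
    intro v
    rw [hσ v (by simpa using hX v v.2), hx v]
  · simp only [value, List.toFinset_nil, Finset.compl_empty, SpinSystem.avg_univ_eq_marginal]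

/-- Almost sure halting makes the output events cover a set of measure one, so their probabilities
sum to at least one. Each is at most its marginal and the marginals sum to one, so equality holds
term by term; no optional stopping argument is needed. -/
theorem measure_finishesIn [NeZero q] (hS : S.Tractable δ) (hδ : 0 < δ)
    (τ : query.toFinset → Fin q) :
    tapeMeasure (finishesIn adj δ query {x | ∀ v : query.toFinset, x v = τ v}) =
      ENNReal.ofReal (S.marginal query.toFinset τ) := by
  set E : (query.toFinset → Fin q) → Set RandomTape := fun τ =>
    finishesIn adj δ query {x | ∀ v : query.toFinset, x v = τ v}
  have hle : ∀ τ ∈ Finset.univ, tapeMeasure.real (E τ) ≤ S.marginal query.toFinset τ :=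
    fun τ _ => ENNReal.toReal_le_of_le_ofReal (SpinSystem.marginal_nonneg _ τ)
      (measure_finishesIn_le hS hδ τ)
  have hge : 1 ≤ ∑ τ, tapeMeasure.real (E τ) := by
    have hU : tapeMeasure.real (⋃ τ, E τ) = 1 := by
      have h : ∀ᵐ ω ∂tapeMeasure, ω ∈ ⋃ τ, E τ := by
        filter_upwards [ae_finishes (adj := adj) (query := query) hS hδ] with ω ⟨t, x, T, ht⟩
        exact Set.mem_iUnion.2 ⟨fun v => x v, t, x, fun _ => rfl, T, ht⟩
      exact (measureReal_congr (Filter.eventuallyEq_univ.2 h)).trans probReal_univ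
    rw [← hU]
    exact measureReal_iUnion_fintype_le _
  have hsum : ∑ τ, tapeMeasure.real (E τ) = ∑ τ, S.marginal query.toFinset τ :=
    le_antisymm (Finset.sum_le_sum hle) ((hS.sum_marginal hδ _).trans_le hge)
  have h := (Finset.sum_eq_sum_iff_of_le hle).1 hsum τ (Finset.mem_univ τ)
  rw [← h, ofReal_measureReal]

theorem lintegral_runTime_le [NeZero q] (hS : S.Tractable δ) (hδ : 0 < δ) :
    ∫⁻ ω, runTime Program.main ⟨n, q, S, adj⟩ δ query ω ∂tapeMeasure ≤
      ENNReal.ofReal (20 + queuePotential 300 (callBound S δ) query) := by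
  have hcost := stepCost_nonneg (n := n) (q := q) (C := 300) (L := Nat.clog 2 q) (by norm_num)
    (Nat.cast_nonneg _)
  calc ∫⁻ ω, runTime Program.main ⟨n, q, S, adj⟩ δ query ω ∂tapeMeasure
      ≤ ∫⁻ ω, (ENNReal.ofReal 20 + ∑' t, ENNReal.ofReal (stepCost 300 (Nat.clog 2 q)
          (trajectory adj (threshold S δ) query t ω))) ∂tapeMeasure := by
        refine lintegral_mono_ae ?_
        filter_upwards [ae_tape_lt_one, ae_finishes (adj := adj) (query := query) hS hδ]
          with ω hu ⟨t, x, T, ht⟩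
        obtain ⟨k, s, he, hk, -⟩ := exec_main hS hu ht
        refine (iInf₂_le k ⟨s, he⟩).trans ?_
        rw [← ENNReal.ofReal_natCast]
        refine (ENNReal.ofReal_le_ofReal hk).trans ?_
        rw [add_comm, ENNReal.ofReal_add (by norm_num) (Finset.sum_nonneg fun i _ => hcost _),
          ENNReal.ofReal_sum_of_nonneg fun i _ => hcost _]
        gcongr
        exact ENNReal.sum_le_tsum _
    _ ≤ ENNReal.ofReal 20 + ENNReal.ofReal (queuePotential 300 (callBound S δ) query) := by
        rw [lintegral_add_left measurable_const, lintegral_const, measure_univ, mul_one]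
        gcongr
        exact TapeChain.lintegral_tsum_cost_le (measurable_step adj (threshold S δ))
          (x₀ := .idle (fun _ => 0) query []) (p := Inv adj query.toFinset)
          (fun _ hv => .inl (List.mem_toFinset.1 hv))
          (fun X u => inv_step adj _ _ X u) (ofReal_stepCost_add_lintegral_le hS hδ)
    _ = _ := by
        rw [← ENNReal.ofReal_add (by norm_num)
          (queuePotential_nonneg (by norm_num) (callBound_nonneg hδ) _)]

/-- With `r = log₂ q ≥ 1` and `Δ ≥ 1`, all lower-order terms are absorbed into `Δ r`. Rounding gives
`clog q ≤ 2r`, hence `1202 = 1200 + 2`; the constant `620` collects `20`, `300` and the `300` per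
query. -/
theorem queuePotential_le (hS : S.Tractable δ) (hδ : 0 < δ) (hq : 2 ≤ q) (l : List (Fin n)) :
    20 + queuePotential 300 (callBound S δ) l ≤
      ((620 + 1202 / δ) / Real.log 2) * (S.maxDeg * Real.log q * max 1 (l.length : ℝ)) := by
  have hlog2 : 0 < Real.log 2 := Real.log_pos (by norm_num)
  have hΔ : (1 : ℝ) ≤ S.maxDeg := by exact_mod_cast hS.one_le_maxDeg
  have hM : (1 : ℝ) ≤ max 1 (l.length : ℝ) := le_max_left _ _
  have hlM : (l.length : ℝ) ≤ max 1 (l.length : ℝ) := le_max_right _ _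
  set M := max 1 (l.length : ℝ)
  set r := Real.log q / Real.log 2 with hr
  have hr1 : 1 ≤ r := by
    rw [hr, one_le_div hlog2]
    exact Real.log_le_log (by norm_num) (by exact_mod_cast hq)
  have hclog : (Nat.clog 2 q : ℝ) ≤ 2 * r := by
    have h₁ : (Nat.clog 2 q : ℝ) ≤ Nat.log 2 q + 1 := by
      exact_mod_cast Nat.clog_le_of_le_pow (Nat.lt_pow_succ_log_self (by norm_num) q).le
    have h₂ : (Nat.log 2 q : ℝ) ≤ r := by
      have := Real.natLog_le_logb q 2
      simpa [Real.logb, hr] using this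
    linarith
  have hB : callBound S δ ≤ 1202 / δ * (S.maxDeg * r) := by
    rw [callBound, div_mul_eq_mul_div]
    gcongr
    nlinarith
  have hB₀ := callBound_nonneg (S := S) hδ
  have hDr : 1 ≤ (S.maxDeg : ℝ) * r := by nlinarith
  have hrhs : ((620 + 1202 / δ) / Real.log 2) * (S.maxDeg * Real.log q * M) =
      (620 + 1202 / δ) * (S.maxDeg * r) * M := by
    rw [hr]; field_simp
  rw [hrhs, queuePotential]
  calc 20 + (300 + l.length * (300 + callBound S δ))
      ≤ 320 * M + M * (300 + callBound S δ) := by nlinarith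
    _ = (620 + callBound S δ) * M := by ring
    _ ≤ (620 + 1202 / δ) * (S.maxDeg * r) * M := by
      gcongr
      nlinarith

end LazySampler

theorem theorem1p2 :
    ∃ P : RAM.Cmd, ∀ δ : ℝ, 0 < δ → ∃ K : ℝ, 0 < K ∧
      ∀ (n q : ℕ) (S : SpinSystem n q) (adj : AdjacencyList S.graph),
        2 ≤ q → S.Tractable δ →
        ∀ (Λ : Finset (Fin n)) (query : List (Fin n)), query.Nodup → query.toFinset = Λ →
          (∀ᵐ ω ∂tapeMeasure, RAM.Halts P ⟨n, q, S, adj⟩ δ query ω) ∧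
          (∀ τ : Λ → Fin q,
            tapeMeasure {ω | RAM.Outputs P ⟨n, q, S, adj⟩ δ query ω Λ τ} =
              ENNReal.ofReal (S.marginal Λ τ)) ∧
          ∫⁻ ω, RAM.runTime P ⟨n, q, S, adj⟩ δ query ω ∂tapeMeasure ≤
            ENNReal.ofReal (K * ((S.maxDeg : ℝ) * Real.log q * max 1 (Λ.card : ℝ))) := by
  refine ⟨LazySampler.Program.main, fun δ hδ => ⟨(620 + 1202 / δ) / Real.log 2, ?_, ?_⟩⟩
  · have := Real.log_pos (show (1 : ℝ) < 2 by norm_num)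
    positivity
  intro n q S adj hq hS Λ query hnd hΛ
  subst hΛ
  have : NeZero q := ⟨by omega⟩
  have hfin := LazySampler.ae_finishes (adj := adj) (query := query) hS hδ
  refine ⟨?_, fun τ => ?_, ?_⟩
  · filter_upwards [ae_tape_lt_one, hfin] with ω hu ⟨t, x, T, ht⟩
    obtain ⟨k, s, he, -, -⟩ := LazySampler.exec_main hS hu ht
    exact ⟨k, s, he⟩
  · rw [← LazySampler.measure_finishesIn (adj := adj) hS hδ τ]
    refine measure_congr ?_
    filter_upwards [ae_tape_lt_one, hfin] with ω hu ⟨t, x, T, ht⟩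
    obtain ⟨k, s, he, -, hv⟩ := LazySampler.exec_main hS hu ht
    refine propext ⟨?_, ?_⟩
    · rintro ⟨k', s', he', hτ⟩
      obtain ⟨-, rfl⟩ := he.det he'
      refine ⟨t, x, fun v => Fin.ext ?_, T, ht⟩
      have := (hv v).symm.trans (hτ v)
      exact_mod_cast this
    · rintro ⟨t', x', hx', T', ht'⟩
      obtain ⟨k', s', he', -, hv'⟩ := LazySampler.exec_main hS hu ht'
      exact ⟨k', s', he', fun v => by rw [hv' v, hx' v]⟩
  · refine (LazySampler.lintegral_runTime_le hS hδ).trans (ENNReal.ofReal_le_ofReal ?_)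
    rw [List.toFinset_card_of_nodup hnd]
    exact LazySampler.queuePotential_le hS hδ hq query
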